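/- Let $D^{1,2}(\mathbb{R}^3)$ be the space of real-valued functions $u\in L^6(\mathbb{R}^3)$ whose weak gradient $\nabla u$ belongs to $L^2(\mathbb{R}^3)$. Let $E_r(\mathbb{R}^3)$ be the space of radial functions $u\in D^{1,2}(\mathbb{R}^3)$ with finite Coulomb energy $$\int_{\mathbb{R}^3}\int_{\mathbb{R}^3}\frac{u^2(x)\,u^2(y)}{|x-y|}\,dx\,dy<+\infty,$$ endowed with the norm $$\|u\|_E=\left(\int_{\mathbb{R}^3}|\nabla u|^2\,dx+\left(\int_{\mathbb{R}^3}\int_{\mathbb{R}^3}\frac{u^2(x)\,u^2(y)}{|x-y|}\,dx\,dy\right)^{1/2}\right)^{1/2}.$$ (As usual, functions are identified when they agree almost everywhere.) Then: 1. For every $p\in(\frac{18}{7},6]$, $E_r(\mathbb{R}^3)\subset L^p(\mathbb{R}^3)$ with continuous inclusion: there is a constant $C=C(p)$ such that $\|u\|_{L^p}\le C\|u\|_E$ for all $u\in E_r(\mathbb{R}^3)$. 2. For every $p\in(\frac{18}{7},6)$ this inclusion is compact: every sequence in $E_r(\mathbb{R}^3)$ that is bounded in $\|\cdot\|_E$ has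 a subsequence that converges in $L^p(\mathbb{R}^3)$. 3. For every $p\in(0,\frac{18}{7})$ and every $p\in(6,\infty]$, $E_r(\mathbb{R}^3)$ is not contained in $L^p(\mathbb{R}^3)$. -/

import Mathlib

open MeasureTheory Filter
open scoped ENNReal NNReal Topology ContDiff

namespace Coulomb

/-- Euclidean space `ℝ³`, with Lebesgue measure `volume`. -/
abbrev R3 : Type := EuclideanSpace ℝ (Fin 3)

/-- `g` is a weak (distributional) gradient of `u` on `ℝ³`:
`∫ u ∂ᵢφ = - ∫ gᵢ φ` for every test function `φ ∈ C₀^∞(ℝ³)` and every `i`. -/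
structure IsWeakGradient (u : R3 → ℝ) (g : R3 → R3) : Prop where
  locallyIntegrable : LocallyIntegrable u volume
  locallyIntegrable_grad : LocallyIntegrable g volume
  integral_eq : ∀ φ : R3 → ℝ, ContDiff ℝ ∞ φ → HasCompactSupport φ → ∀ i : Fin 3,
    ∫ x, u x * fderiv ℝ φ x (EuclideanSpace.single i 1) = - ∫ x, g x i * φ x

open Classical in
/-- The weak gradient of `u` (unique almost everywhere); the value is `0` if there is none. -/
noncomputable def weakGrad (u : R3 → ℝ) : R3 → R3 :=
  if h : ∃ g, IsWeakGradient u g then h.choose else 0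

/-- `u ∈ D^{1,2}(ℝ³)`: `u ∈ L⁶` has a weak gradient in `L²`. -/
structure MemD12 (u : R3 → ℝ) : Prop where
  memLp_six : MemLp u 6 volume
  exists_grad : ∃ g, IsWeakGradient u g ∧ MemLp g 2 volume

/-- The Coulomb energy `∫∫ u(x)² u(y)² / |x - y| dx dy`, with values in `[0, ∞]`. -/
noncomputable def energy (u : R3 → ℝ) : ℝ≥0∞ :=
  ∫⁻ x, ∫⁻ y, ENNReal.ofReal (u x ^ 2 * u y ^ 2 / ‖x - y‖)

/-- `u` is (almost everywhere equal to) a function of `|x|`. -/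
def IsRadial (u : R3 → ℝ) : Prop :=
  ∃ f : ℝ → ℝ, ∀ᵐ x : R3, u x = f ‖x‖

/-- `u ∈ E_r(ℝ³)`: radial functions of `D^{1,2}(ℝ³)` with finite Coulomb energy. -/
structure MemEr (u : R3 → ℝ) : Prop where
  memD12 : MemD12 u
  energy_lt_top : energy u < ⊤
  radial : IsRadial u

/-- The norm of `E`:
`‖u‖_E = (∫ |∇u|² + (∫∫ u(x)² u(y)² / |x - y| dx dy)^{1/2})^{1/2}`, with values in `[0, ∞]`. -/
noncomputable def normE (u : R3 → ℝ) : ℝ≥0∞ :=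
  ((∫⁻ x, ‖weakGrad u x‖ₑ ^ 2) + energy u ^ (1 / 2 : ℝ)) ^ (1 / 2 : ℝ)

end Coulomb

namespace Coulomb

open Set Metric
open scoped Convolution

/-! A radial function with a square-integrable weak gradient behaves like a function of one
variable. Writing `M` for a bound on the norm, Cauchy–Schwarz along the radius gives `(u(x) - u(y))²
≲ M² (1/|x| - 1/|y|)` for `|x| ≤ |y|` (`exists_ae_mem_enorm_sub_le`, `Controlled.sq_sub_le`). The
Coulomb energy controls mass: two points of a dyadic annulus of radius `R` are at most `4R` apart,
so `∫ u² ≲ M² √R` there (`lintegral_sq_le_of_energy_le`). Averaging `u²` over a shell of thickness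
`l` and moving from a good point of that shell to `x` bounds `u(x)²` by `M² (l/|x|² + √|x|/(|x|²
l))` up to a constant. The optimal `l = |x|^(1/4)` gives `|u(x)| ≲ M |x|^(-7/8)` for `|x| ≥ 1`; near
the origin the oscillation bound alone gives `|u(x)| ≲ M |x|^(-1/2)`.

Outside the unit ball, `|u|^p ≤ (sup |u|)^(p-2) u²` on the annulus of radius `2^k` contributes at
most a multiple of `2^(k(1/2 - 7(p-2)/8))`, a convergent geometric series precisely when `p > 18/7`.
Inside, `|x|^(-p/2)` is integrable for `p < 6`; the endpoint `p = 6` follows from a Hardy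
inequality.

For compactness, the oscillation bound is a common modulus of continuity away from the origin, so a
subsequence converges almost everywhere (`exists_subseq_tendsto`). Dominated convergence handles
balls, and decay combined with an `L^q` bound, `18/7 < q < p`, handles the tails.

The counterexamples are sums of bumps on disjoint shells with radius `R`, thickness `l` and height
`h`. Up to constants a shell contributes at most `h² R²/l` to the gradient integral, and the energy
is at most the square of `∑ h² R^(3/2) l`, because the potential of a shell is at most a multiple of
`l R` (`lintegral_shell_le`). Geometric progressions saturating the pointwise bounds then make the
`L^p` integral diverge: shells with `l = R^(1/4)` going to infinity for `p < 18/7`, dyadic shells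
shrinking to the origin for `p > 6`. -/

/-- The area `4π` of the unit sphere of `ℝ³`. -/
noncomputable def sphereArea : ℝ := 3 * volume.real (ball (0 : R3) 1)

lemma sphereArea_pos : 0 < sphereArea := by
  have h : 0 < volume.real (ball (0 : R3) 1) :=
    ENNReal.toReal_pos (measure_ball_pos volume _ one_pos).ne' measure_ball_lt_top.ne
  unfold sphereArea
  positivity

/-! ### Polar coordinates: radial integrals and radial null sets. -/

lemma finrank_R3 : Module.finrank ℝ R3 = 3 := by simp

lemma lintegral_fun_norm {f : ℝ → ℝ≥0∞} (hf : Measurable f) :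
    ∫⁻ x : R3, f ‖x‖ =
      ENNReal.ofReal sphereArea * ∫⁻ r in Ioi (0 : ℝ), ENNReal.ofReal (r ^ 2) * f r := by
  have hmp := (volume : Measure R3).measurePreserving_homeomorphUnitSphereProd
  have h1 : ∫⁻ x : R3, f ‖x‖ =
      ∫⁻ x : ({0}ᶜ : Set R3), f ‖x.1‖ ∂((volume : Measure R3).comap Subtype.val) := by
    rw [lintegral_subtype_comap (measurableSet_singleton _).compl fun x : R3 => f ‖x‖,
      restrict_compl_singleton]
  have h2 : ∫⁻ x : ({0}ᶜ : Set R3), f ‖x.1‖ ∂((volume : Measure R3).comap Subtype.val) =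
      ∫⁻ z, f z.2 ∂((volume : Measure R3).toSphere.prod (.volumeIoiPow 2)) := by
    have := hmp.lintegral_comp (f := fun z => f z.2) (by fun_prop)
    simpa [finrank_R3] using this
  rw [h1, h2, lintegral_prod _ (by fun_prop)]
  simp only [lintegral_const, Measure.toSphere_apply_univ, finrank_R3]
  rw [mul_comm, Measure.volumeIoiPow, lintegral_withDensity_eq_lintegral_mul _ (by fun_prop)
    (by fun_prop)]
  simp only [Pi.mul_apply]
  rw [lintegral_subtype_comap measurableSet_Ioi fun r : ℝ => ENNReal.ofReal (r ^ 2) * f r]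
  congr 1
  rw [sphereArea, ENNReal.ofReal_mul (by norm_num), measureReal_def,
    ENNReal.ofReal_toReal measure_ball_lt_top.ne]
  simp

lemma measurableSet_norm_mem {s : Set ℝ} (hs : MeasurableSet s) :
    MeasurableSet {x : R3 | ‖x‖ ∈ s} :=
  hs.preimage measurable_norm

lemma setLIntegral_fun_norm {s : Set ℝ} (hs : MeasurableSet s) (h0 : s ⊆ Ioi 0)
    {f : ℝ → ℝ≥0∞} (hf : Measurable f) :
    ∫⁻ x in {x : R3 | ‖x‖ ∈ s}, f ‖x‖ =
      ENNReal.ofReal sphereArea * ∫⁻ r in s, ENNReal.ofReal (r ^ 2) * f r := by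
  rw [← lintegral_indicator (measurableSet_norm_mem hs)]
  have h1 : (fun x : R3 => ({x : R3 | ‖x‖ ∈ s}).indicator (fun x => f ‖x‖) x) =
      fun x : R3 => s.indicator f ‖x‖ := by
    ext x
    by_cases hx : ‖x‖ ∈ s <;> simp [indicator, hx]
  rw [h1, lintegral_fun_norm (hf.indicator hs)]
  congr 1
  have h2 : ∀ r : ℝ, ENNReal.ofReal (r ^ 2) * s.indicator f r =
      s.indicator (fun r => ENNReal.ofReal (r ^ 2) * f r) r := by
    intro r
    by_cases hr : r ∈ s <;> simp [hr]
  simp_rw [h2]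
  rw [lintegral_indicator hs, Measure.restrict_restrict hs, inter_eq_left.2 h0]

/-- This transfers almost-everywhere statements about the profile on the line to points of space.
The origin is added by hand since the polar formula only sees positive radii. -/
lemma volume_norm_mem_eq_zero {s : Set ℝ} (hs : volume s = 0) :
    volume {x : R3 | ‖x‖ ∈ s} = 0 := by
  obtain ⟨t, hst, htm, ht⟩ := exists_measurable_superset_of_null hs
  have h := setLIntegral_fun_norm (htm.inter measurableSet_Ioi) inter_subset_right
    (measurable_const (a := (1 : ℝ≥0∞)))
  rw [setLIntegral_measure_zero _ _ (measure_mono_null inter_subset_left ht)] at h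
  simp only [lintegral_const, MeasurableSet.univ, Measure.restrict_apply, univ_inter, one_mul,
    mul_zero] at h
  refine measure_mono_null (t := {x : R3 | ‖x‖ ∈ t ∩ Ioi 0} ∪ {0}) ?_
    (measure_union_null h (measure_singleton _))
  intro x hx
  by_cases h0 : x = 0
  · exact Or.inr h0
  · exact Or.inl ⟨hst hx, norm_pos_iff.2 h0⟩

lemma ae_norm_of_ae {p : ℝ → Prop} (h : ∀ᵐ r, p r) : ∀ᵐ x : R3, p ‖x‖ :=
  volume_norm_mem_eq_zero h

lemma ofReal_sq_mul_rpow {r a : ℝ} (hr : 0 < r) :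
    ENNReal.ofReal (r ^ 2) * ENNReal.ofReal (r ^ a) = ENNReal.ofReal (r ^ (2 + a)) := by
  rw [← ENNReal.ofReal_mul (by positivity), Real.rpow_add hr, Real.rpow_two]

lemma setLIntegral_norm_rpow_Ioc {a R : ℝ} (ha : -3 < a) (hR : 0 ≤ R) :
    ∫⁻ x in {x : R3 | ‖x‖ ∈ Ioc 0 R}, ENNReal.ofReal (‖x‖ ^ a) =
      ENNReal.ofReal (sphereArea * (R ^ (3 + a) / (3 + a))) := by
  rw [setLIntegral_fun_norm (f := fun r => ENNReal.ofReal (r ^ a)) measurableSet_Ioc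
    (fun _ h => h.1) (by fun_prop), ENNReal.ofReal_mul sphereArea_pos.le]
  congr 1
  rw [setLIntegral_congr_fun measurableSet_Ioc (fun r hr => ofReal_sq_mul_rpow hr.1),
    ← ofReal_integral_eq_lintegral_ofReal, ← intervalIntegral.integral_of_le hR,
    integral_rpow (Or.inl (by linarith))]
  · congr 1
    rw [Real.zero_rpow (by linarith)]
    ring_nf
  · exact (intervalIntegral.intervalIntegrable_rpow' (by linarith)).1
  · filter_upwards [ae_restrict_mem measurableSet_Ioc] with r hr
    exact Real.rpow_nonneg hr.1.le _

lemma setLIntegral_norm_rpow_Ioi {a R : ℝ} (ha : a < -3) (hR : 0 < R) :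
    ∫⁻ x in {x : R3 | ‖x‖ ∈ Ioi R}, ENNReal.ofReal (‖x‖ ^ a) =
      ENNReal.ofReal (sphereArea * (R ^ (3 + a) / (-3 - a))) := by
  have h0 : Ioi R ⊆ Ioi 0 := Ioi_subset_Ioi hR.le
  rw [setLIntegral_fun_norm (f := fun r => ENNReal.ofReal (r ^ a)) measurableSet_Ioi
    h0 (by fun_prop), ENNReal.ofReal_mul sphereArea_pos.le]
  congr 1
  rw [setLIntegral_congr_fun measurableSet_Ioi (fun r hr => ofReal_sq_mul_rpow (h0 hr)),
    ← ofReal_integral_eq_lintegral_ofReal, integral_Ioi_rpow_of_lt (by linarith) hR]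
  · congr 1
    rw [← neg_div_neg_eq, neg_neg]
    ring_nf
  · exact integrableOn_Ioi_rpow_of_lt (by linarith) hR
  · filter_upwards [ae_restrict_mem measurableSet_Ioi] with r hr
    exact Real.rpow_nonneg (h0 hr).le _

/-- The weight of the oscillation bound is `‖z‖ ^ (-2)`; Cauchy–Schwarz squares it, and this is the
resulting factor. -/
lemma setLIntegral_norm_rpow_neg_four {r s : ℝ} (hr : 0 < r) (hrs : r ≤ s) :
    ∫⁻ x in {x : R3 | ‖x‖ ∈ Ioc r s}, ENNReal.ofReal (‖x‖ ^ (-4 : ℝ)) =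
      ENNReal.ofReal (sphereArea * (1 / r - 1 / s)) := by
  have h0 : Ioc r s ⊆ Ioi 0 := fun t h => hr.trans h.1
  rw [setLIntegral_fun_norm (f := fun r => ENNReal.ofReal (r ^ (-4 : ℝ))) measurableSet_Ioc
    h0 (by fun_prop), ENNReal.ofReal_mul sphereArea_pos.le]
  congr 1
  have h1 : (0 : ℝ) ∉ uIcc r s := by
    rw [uIcc_of_le hrs]; exact fun h => absurd h.1 (not_le.2 hr)
  rw [setLIntegral_congr_fun measurableSet_Ioc (fun r hr => ofReal_sq_mul_rpow (h0 hr)),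
    ← ofReal_integral_eq_lintegral_ofReal, ← intervalIntegral.integral_of_le hrs,
    integral_rpow (Or.inr ⟨by norm_num, h1⟩)]
  · congr 1
    have e : (2 + -4 + 1 : ℝ) = -1 := by norm_num
    rw [e, Real.rpow_neg_one, Real.rpow_neg_one]
    ring
  · exact (intervalIntegral.intervalIntegrable_rpow (Or.inr h1)).1
  · filter_upwards [ae_restrict_mem measurableSet_Ioc] with r hr
    exact Real.rpow_nonneg (h0 hr).le _

lemma volume_norm_mem_Ioc {r s : ℝ} (hr : 0 ≤ r) (hrs : r ≤ s) :
    volume {x : R3 | ‖x‖ ∈ Ioc r s} = ENNReal.ofReal (sphereArea * ((s ^ 3 - r ^ 3) / 3)) := by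
  have h0 : Ioc r s ⊆ Ioi 0 := fun t h => hr.trans_lt h.1
  have h := setLIntegral_fun_norm measurableSet_Ioc h0 (measurable_const (a := (1 : ℝ≥0∞)))
  simp only [lintegral_const, MeasurableSet.univ, Measure.restrict_apply, univ_inter, one_mul,
    mul_one] at h
  rw [h, ENNReal.ofReal_mul sphereArea_pos.le, ← ofReal_integral_eq_lintegral_ofReal,
    ← intervalIntegral.integral_of_le hrs, integral_pow]
  · norm_num
  · exact (intervalIntegral.intervalIntegrable_pow 2).1
  · exact Eventually.of_forall fun x => sq_nonneg x

/-! ### Radial functions and radial vector fields -/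

lemma contDiff_comp_norm {q : ℝ → ℝ} {a : ℝ} (ha : 0 < a) (h0 : ∀ t ≤ a, q t = 0)
    (hq : ∀ t, 0 < t → ContDiffAt ℝ ∞ q t) : ContDiff ℝ ∞ fun x : R3 => q ‖x‖ := by
  rw [contDiff_iff_contDiffAt]
  intro x
  by_cases hx : x = 0
  · subst hx
    have : (fun x : R3 => q ‖x‖) =ᶠ[𝓝 0] fun _ => 0 := by
      filter_upwards [ball_mem_nhds (0 : R3) ha] with y hy
      exact h0 _ (mem_ball_zero_iff.1 hy).le
    exact contDiffAt_const.congr_of_eventuallyEq this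
  · exact (hq _ (norm_pos_iff.2 hx)).comp x (contDiffAt_norm ℝ hx)

lemma hasFDerivAt_comp_norm {q : ℝ → ℝ} {q' : ℝ} {x : R3} (hx : x ≠ 0)
    (hq : HasDerivAt q q' ‖x‖) :
    HasFDerivAt (fun x : R3 => q ‖x‖) ((q' / ‖x‖) • innerSL ℝ x) x := by
  have hn : HasFDerivAt (fun x : R3 => ‖x‖) (‖x‖⁻¹ • innerSL ℝ x) x := by
    have h1 := (hasStrictFDerivAt_norm_sq x).hasFDerivAt
    have h2 := h1.sqrt (by positivity)
    simp only [norm_nonneg, Real.sqrt_sq] at h2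
    refine h2.congr_fderiv ?_
    ext y
    simp
    field_simp
  refine (hq.comp_hasFDerivAt x hn).congr_fderiv ?_
  rw [smul_smul, div_eq_mul_inv]

lemma hasCompactSupport_comp_norm {q : ℝ → ℝ} {b : ℝ} (hb : ∀ t, b ≤ t → q t = 0) :
    HasCompactSupport fun x : R3 => q ‖x‖ := by
  refine HasCompactSupport.of_support_subset_isCompact (isCompact_closedBall (0 : R3) b) ?_
  intro x hx
  rw [mem_closedBall_zero_iff]
  by_contra h
  exact hx (hb _ (not_le.1 h).le)

lemma fderiv_coord_mul_comp_norm {q : ℝ → ℝ} {q' : ℝ} {x : R3} (hx : x ≠ 0)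
    (hq : HasDerivAt q q' ‖x‖) (i : Fin 3) :
    fderiv ℝ (fun x : R3 => x i * q ‖x‖) x (EuclideanSpace.single i 1) =
      q ‖x‖ + x i ^ 2 * (q' / ‖x‖) := by
  have h1 : HasFDerivAt (fun x : R3 => x i) (EuclideanSpace.proj i : R3 →L[ℝ] ℝ) x :=
    (EuclideanSpace.proj i : R3 →L[ℝ] ℝ).hasFDerivAt
  have h2 : HasFDerivAt (fun x : R3 => x i * q ‖x‖) _ x :=
    h1.mul (hasFDerivAt_comp_norm hx hq)
  rw [h2.fderiv]
  simp [EuclideanSpace.inner_single_right]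
  ring

/-- The field `x / ‖x‖ ^ 3` is divergence free away from the origin, so only the derivative of `η`
survives. -/
lemma sum_fderiv_coord_mul_comp_norm {η : ℝ → ℝ} {η' : ℝ} {x : R3} (hx : x ≠ 0)
    (hη : HasDerivAt η η' ‖x‖) :
    ∑ i, fderiv ℝ (fun x : R3 => x i * (η ‖x‖ / ‖x‖ ^ 3)) x (EuclideanSpace.single i 1) =
      η' / ‖x‖ ^ 2 := by
  have hn : ‖x‖ ≠ 0 := norm_ne_zero_iff.2 hx
  have hq := hη.div (hasDerivAt_pow 3 ‖x‖) (pow_ne_zero 3 hn)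
  have h := fun i => fderiv_coord_mul_comp_norm (q := fun t => η t / t ^ 3) hx hq i
  rw [Finset.sum_congr rfl fun i _ => h i, Finset.sum_add_distrib, ← Finset.sum_mul]
  have h2 : ∑ i, x i ^ 2 = ‖x‖ ^ 2 := by
    rw [EuclideanSpace.norm_sq_eq]; simp
  rw [h2]
  simp
  field_simp
  ring

lemma _root_.MeasureTheory.LocallyIntegrable.apply_coord {g : R3 → R3}
    (hg : LocallyIntegrable g volume) (i : Fin 3) : LocallyIntegrable (fun x => g x i) := by
  intro x
  obtain ⟨s, hs, h⟩ := hg x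
  exact ⟨s, hs, (EuclideanSpace.proj i : R3 →L[ℝ] ℝ).integrable_comp h⟩

/-- The weak radial derivative of a radial function is bounded by the gradient. -/
lemma enorm_integral_profile_mul_deriv_le {u : R3 → ℝ} {g : R3 → R3} (hg : IsWeakGradient u g)
    {w : ℝ → ℝ} (hw : ∀ᵐ x : R3, u x = w ‖x‖) {η : ℝ → ℝ} (hη : ContDiff ℝ ∞ η) {a b : ℝ}
    (ha : 0 < a) (h0 : ∀ t ≤ a, η t = 0) (hb : ∀ t, b ≤ t → η t = 0) :
    ENNReal.ofReal sphereArea * ‖∫ t in Ioi 0, w t * deriv η t‖ₑ ≤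
      ∫⁻ z, ‖g z‖ₑ * ENNReal.ofReal (‖z‖ ^ (-2 : ℝ)) * ‖η ‖z‖‖ₑ := by
  -- Components of the test field `η(‖x‖) x / ‖x‖ ^ 3`. It is smooth because `η` vanishes near the
  -- origin, and its divergence `η' / ‖x‖ ^ 2` cancels the polar Jacobian.
  set Φ : Fin 3 → R3 → ℝ := fun i x => x i * (η ‖x‖ / ‖x‖ ^ 3) with hΦ
  have hqs : ContDiff ℝ ∞ fun x : R3 => η ‖x‖ / ‖x‖ ^ 3 := by
    refine contDiff_comp_norm (q := fun t => η t / t ^ 3) ha (fun t ht => by simp [h0 t ht]) ?_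
    intro t ht
    exact hη.contDiffAt.div (contDiffAt_id.pow 3) (pow_ne_zero 3 ht.ne')
  have hqc : HasCompactSupport fun x : R3 => η ‖x‖ / ‖x‖ ^ 3 :=
    hasCompactSupport_comp_norm (q := fun t => η t / t ^ 3) (b := b)
      fun t ht => by simp [hb t ht]
  have hΦs : ∀ i, ContDiff ℝ ∞ (Φ i) := fun i =>
    ((EuclideanSpace.proj i : R3 →L[ℝ] ℝ).contDiff).mul hqs
  have hΦc : ∀ i, HasCompactSupport (Φ i) := fun i => hqc.mul_left
  have hint1 : ∀ i, Integrable fun x =>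
      u x * fderiv ℝ (Φ i) x (EuclideanSpace.single i 1) := by
    intro i
    have hc : Continuous fun x => fderiv ℝ (Φ i) x (EuclideanSpace.single i 1) :=
      ((hΦs i).continuous_fderiv (by simp)).clm_apply continuous_const
    have hs : HasCompactSupport fun x => fderiv ℝ (Φ i) x (EuclideanSpace.single i 1) :=
      (hΦc i).fderiv_apply ℝ _
    simpa [mul_comm] using
      hg.locallyIntegrable.integrable_smul_left_of_hasCompactSupport hc hs
  have hint2 : ∀ i, Integrable fun x => g x i * Φ i x := by
    intro i
    simpa [mul_comm] using
      (hg.locallyIntegrable_grad.apply_coord i).integrable_smul_left_of_hasCompactSupport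
      (hΦs i).continuous (hΦc i)
  have hsum : ∫ x, ∑ i, u x * fderiv ℝ (Φ i) x (EuclideanSpace.single i 1) =
      - ∫ x, ∑ i, g x i * Φ i x := by
    rw [integral_finsetSum _ fun i _ => hint1 i, integral_finsetSum _ fun i _ => hint2 i,
      ← Finset.sum_neg_distrib]
    exact Finset.sum_congr rfl fun i _ => hg.integral_eq (Φ i) (hΦs i) (hΦc i) i
  have hleft : ∫ x, ∑ i, u x * fderiv ℝ (Φ i) x (EuclideanSpace.single i 1) =
      sphereArea * ∫ t in Ioi 0, w t * deriv η t := by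
    have h1 : ∫ x, ∑ i, u x * fderiv ℝ (Φ i) x (EuclideanSpace.single i 1) =
        ∫ x : R3, (fun t => w t * (deriv η t / t ^ 2)) ‖x‖ := by
      apply integral_congr_ae
      have hne : ∀ᵐ x : R3, x ≠ 0 := by simp [ae_iff]
      filter_upwards [hw, hne] with x hx hx0
      rw [← Finset.mul_sum, hx, sum_fderiv_coord_mul_comp_norm hx0
        (hη.differentiable (by simp) _).hasDerivAt]
    rw [h1, integral_fun_norm_addHaar volume (fun t => w t * (deriv η t / t ^ 2)), finrank_R3,
      sphereArea, nsmul_eq_mul, smul_eq_mul,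
      ← mul_assoc]
    congr 1
    refine setIntegral_congr_fun measurableSet_Ioi fun t ht => ?_
    have ht' : t ≠ 0 := (mem_Ioi.1 ht).ne'
    simp
    field_simp
  rw [hleft] at hsum
  have h3 : ENNReal.ofReal sphereArea * ‖∫ t in Ioi 0, w t * deriv η t‖ₑ =
      ‖∫ x, ∑ i, g x i * Φ i x‖ₑ := by
    rw [← enorm_neg (∫ x, ∑ i, g x i * Φ i x), ← hsum, enorm_mul,
      Real.enorm_of_nonneg sphereArea_pos.le]
  rw [h3]
  refine (enorm_integral_le_lintegral_enorm _).trans (lintegral_mono fun x => ?_)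
  have h4 : ∑ i, g x i * Φ i x = inner ℝ x (g x) * (η ‖x‖ / ‖x‖ ^ 3) := by
    rw [PiLp.inner_apply, Finset.sum_mul]
    refine Finset.sum_congr rfl fun i _ => ?_
    simp [hΦ]
    ring
  rw [h4, enorm_mul]
  by_cases hx : x = 0
  · simp [hx]
  have hn : 0 < ‖x‖ := norm_pos_iff.2 hx
  rw [← ofReal_norm, ← ofReal_norm, ← ofReal_norm, ← ofReal_norm,
    ← ENNReal.ofReal_mul (by positivity), ← ENNReal.ofReal_mul (by positivity),
    ← ENNReal.ofReal_mul (by positivity)]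
  apply ENNReal.ofReal_le_ofReal
  have h5 := norm_inner_le_norm (𝕜 := ℝ) x (g x)
  calc _ ≤ (‖x‖ * ‖g x‖) * ‖η ‖x‖ / ‖x‖ ^ 3‖ := by gcongr
    _ = _ := by
      rw [norm_div, norm_pow, norm_norm, Real.rpow_neg hn.le, Real.rpow_two]
      field_simp

/-- The distribution function of a normalized bump. -/
lemma exists_primitive_normed (φ : ContDiffBump (0 : ℝ)) :
    ∃ c : ℝ → ℝ, ContDiff ℝ ∞ c ∧ (∀ t, HasDerivAt c (φ.normed volume t) t) ∧
      (∀ t, 0 ≤ c t) ∧ (∀ t, c t ≤ 1) ∧ (∀ t ≤ -φ.rOut, c t = 0) ∧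
      (∀ t, φ.rOut ≤ t → c t = 1) := by
  set ρ := φ.normed volume with hρ
  have hρc : Continuous ρ := φ.continuous_normed
  have hρi : Integrable ρ := φ.integrable_normed
  have hd : ∀ t, HasDerivAt (fun t => ∫ τ in Iic t, ρ τ) (ρ t) t := by
    intro t
    have h1 : (fun t => ∫ τ in Iic t, ρ τ) =
        fun t => (∫ τ in Iic 0, ρ τ) + ∫ τ in (0 : ℝ)..t, ρ τ := by
      ext s
      rw [← intervalIntegral.integral_Iic_sub_Iic hρi.integrableOn hρi.integrableOn]
      ring
    rw [h1]
    exact (intervalIntegral.integral_hasDerivAt_right hρi.intervalIntegrable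
      (hρc.stronglyMeasurableAtFilter _ _) hρc.continuousAt).const_add _
  have hzero : ∀ t, φ.rOut ≤ |t| → ρ t = 0 := by
    intro t ht
    have : t ∉ Function.support ρ := by
      rw [hρ, φ.support_normed_eq, mem_ball_zero_iff, Real.norm_eq_abs]
      exact not_lt.2 ht
    simpa using this
  have hpos := φ.rOut_pos
  refine ⟨fun t => ∫ τ in Iic t, ρ τ, ?_, hd, ?_, ?_, ?_, ?_⟩
  · rw [contDiff_infty_iff_deriv]
    refine ⟨fun t => (hd t).differentiableAt, ?_⟩
    rw [show deriv (fun t => ∫ τ in Iic t, ρ τ) = ρ from funext fun t => (hd t).deriv]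
    exact φ.contDiff_normed
  · intro t
    exact integral_nonneg fun τ => φ.nonneg_normed τ
  · intro t
    rw [← φ.integral_normed (μ := volume)]
    exact setIntegral_le_integral hρi (Eventually.of_forall fun τ => φ.nonneg_normed τ)
  · intro t ht
    refine setIntegral_eq_zero_of_forall_eq_zero fun τ hτ => hzero τ ?_
    have : τ ≤ t := hτ
    rw [abs_of_nonpos (by linarith)]
    linarith
  · intro t ht
    rw [← φ.integral_normed (μ := volume)]
    refine setIntegral_eq_integral_of_forall_compl_eq_zero fun τ hτ => hzero τ ?_
    have : t < τ := not_le.1 hτ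
    rw [abs_of_nonneg (by linarith)]
    linarith

/-- The Jacobian `t ^ 2` is harmless away from the origin, so local integrability passes from `u` to
its profile. Nothing is available near radius `0`, which is why the profile is truncated before it
is mollified. -/
lemma integrableOn_profile {u : R3 → ℝ} (hu : LocallyIntegrable u volume)
    {w : ℝ → ℝ} (hw : ∀ᵐ x : R3, u x = w ‖x‖) {a : ℝ} (b : ℝ) (ha : 0 < a) :
    IntegrableOn w (Icc a b) := by
  set f : ℝ → ℝ := fun t => (Icc a b).indicator w t / t ^ 2 with hf
  have hA : IsCompact {x : R3 | ‖x‖ ∈ Icc a b} := by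
    refine (isCompact_closedBall (0 : R3) b).of_isClosed_subset
      (isClosed_Icc.preimage continuous_norm) fun x hx => ?_
    simpa using hx.2
  have hmA := measurableSet_norm_mem (measurableSet_Icc (a := a) (b := b))
  have h1 : Integrable fun x : R3 => f ‖x‖ := by
    have h2 : IntegrableOn (fun x : R3 => u x * (1 / ‖x‖ ^ 2)) {x : R3 | ‖x‖ ∈ Icc a b} := by
      refine (hu.integrableOn_isCompact hA).mul_continuousOn ?_ hA
      refine continuousOn_const.div (by fun_prop) fun x hx => ?_
      have : 0 < ‖x‖ := ha.trans_le hx.1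
      positivity
    rw [← integrable_indicator_iff hmA] at h2
    refine h2.congr ?_
    filter_upwards [hw] with x hx
    by_cases hxa : ‖x‖ ∈ Icc a b
    · rw [indicator_of_mem (by exact hxa), hf]
      simp only [indicator_of_mem hxa, hx]
      ring
    · rw [indicator_of_notMem (by exact hxa), hf]
      simp only [indicator_of_notMem hxa, zero_div]
  rw [integrable_fun_norm_addHaar] at h1
  have h3 : IntegrableOn ((Icc a b).indicator w) (Ioi 0) := by
    refine h1.congr_fun (fun t ht => ?_) measurableSet_Ioi
    have : t ≠ 0 := (mem_Ioi.1 ht).ne'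
    simp [hf]
    field_simp
  have h4 := h3.mono_set (show Icc a b ⊆ Ioi 0 from fun t ht => ha.trans_le ht.1)
  exact h4.congr_fun (fun t ht => by simp [ht]) measurableSet_Icc

/-! ### Oscillation of radial functions with a weak gradient -/

/-- Take for `η` a smoothed indicator of `[r, s]`, built from a primitive of the mollifier. Its
derivative is a difference of two translated mollifiers, so pairing it with the profile produces the
two mollified values. The conditions on `a` and `b` keep that derivative inside the truncation
window. -/
lemma enorm_convolution_sub_le {u : R3 → ℝ} {g : R3 → R3} (hg : IsWeakGradient u g)
    {w : ℝ → ℝ} (hw : ∀ᵐ x : R3, u x = w ‖x‖) (φ : ContDiffBump (0 : ℝ)) {a b r s : ℝ}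
    (ha : 0 < a) (har : a ≤ r - φ.rOut) (hrs : r ≤ s) (hsb : s + φ.rOut ≤ b) :
    ENNReal.ofReal sphereArea *
      ‖(φ.normed volume ⋆[ContinuousLinearMap.lsmul ℝ ℝ, volume] (Icc a b).indicator w) r -
        (φ.normed volume ⋆[ContinuousLinearMap.lsmul ℝ ℝ, volume] (Icc a b).indicator w) s‖ₑ ≤
      ∫⁻ z in {z : R3 | ‖z‖ ∈ Icc (r - φ.rOut) (s + φ.rOut)},
        ‖g z‖ₑ * ENNReal.ofReal (‖z‖ ^ (-2 : ℝ)) := by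
  obtain ⟨c, hc, hd, hc0, hc1, hcl, hcr⟩ := exists_primitive_normed φ
  set ρ := φ.normed volume with hρ
  set W := (Icc a b).indicator w with hW
  have hWi : LocallyIntegrable W :=
    ((integrableOn_profile hg.locallyIntegrable hw b ha).integrable_indicator
      measurableSet_Icc).locallyIntegrable
  set η : ℝ → ℝ := fun t => c (t - r) - c (t - s) with hη
  have hηs : ContDiff ℝ ∞ η :=
    (hc.comp (contDiff_id.sub contDiff_const)).sub (hc.comp (contDiff_id.sub contDiff_const))
  have hηl : ∀ t ≤ r - φ.rOut, η t = 0 := by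
    intro t ht
    simp only [hη]
    rw [hcl _ (by linarith), hcl _ (by linarith), sub_zero]
  have hηr : ∀ t, s + φ.rOut ≤ t → η t = 0 := by
    intro t ht
    simp only [hη]
    rw [hcr _ (by linarith), hcr _ (by linarith), sub_self]
  have hηd : ∀ t, deriv η t = ρ (t - r) - ρ (t - s) := by
    intro t
    exact (((hd (t - r)).comp_sub_const t r).sub ((hd (t - s)).comp_sub_const t s)).deriv
  have hex : ∀ x, Integrable fun t => ρ (x - t) * W t := fun x =>
    (φ.hasCompactSupport_normed.convolutionExists_left (ContinuousLinearMap.lsmul ℝ ℝ)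
      φ.continuous_normed hWi x).integrable_swap
  have hconv : ∀ x, (ρ ⋆[ContinuousLinearMap.lsmul ℝ ℝ, volume] W) x =
      ∫ t, ρ (x - t) * W t := fun x => by
    rw [convolution_eq_swap]; rfl
  have hρe : ∀ x t, ρ (x - t) = ρ (t - x) := fun x t => by
    rw [← neg_sub, hρ, φ.normed_neg]
  have key : ∫ t in Ioi 0, w t * deriv η t =
      (ρ ⋆[ContinuousLinearMap.lsmul ℝ ℝ, volume] W) r -
        (ρ ⋆[ContinuousLinearMap.lsmul ℝ ℝ, volume] W) s := by
    rw [hconv, hconv, ← integral_sub (hex r) (hex s), ← integral_indicator measurableSet_Ioi]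
    congr 1
    ext t
    by_cases ht : t ∈ Icc a b
    · rw [indicator_of_mem (show t ∈ Ioi 0 from ha.trans_le ht.1), hW, indicator_of_mem ht, hηd,
        hρe r, hρe s]
      ring
    · have h0 : deriv η t = 0 := by
        rw [mem_Icc, not_and_or, not_le, not_le] at ht
        have hev : η =ᶠ[𝓝 t] fun _ => 0 := by
          rcases ht with ht | ht
          · filter_upwards [Iio_mem_nhds ht] with τ hτ
            exact hηl _ (le_trans (le_of_lt hτ) har)
          · filter_upwards [Ioi_mem_nhds ht] with τ hτ
            exact hηr _ (hsb.trans (le_of_lt hτ))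
        rw [hev.deriv_eq]; simp
      rw [hW, indicator_of_notMem ht]
      simp [indicator, h0]
  rw [← key]
  refine (enorm_integral_profile_mul_deriv_le hg hw hηs (ha.trans_le har) hηl hηr).trans ?_
  rw [← lintegral_indicator (measurableSet_norm_mem measurableSet_Icc)]
  refine lintegral_mono fun z => ?_
  by_cases hz : ‖z‖ ∈ Icc (r - φ.rOut) (s + φ.rOut)
  · rw [indicator_of_mem (by exact hz)]
    refine mul_le_of_le_one_right' ?_
    rw [← ofReal_norm, ENNReal.ofReal_le_one, Real.norm_eq_abs, abs_le]
    constructor <;> simp only [hη] <;> linarith [hc0 (‖z‖ - r), hc0 (‖z‖ - s), hc1 (‖z‖ - r),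
      hc1 (‖z‖ - s)]
  · rw [indicator_of_notMem (by exact hz)]
    rw [mem_Icc, not_and_or, not_le, not_le] at hz
    have : η ‖z‖ = 0 := hz.elim (fun h => hηl _ h.le) (fun h => hηr _ h.le)
    simp [this]

/-- The weighted gradient mass of an annulus depends continuously on the annulus. -/
lemma tendsto_setLIntegral_annulus {g : R3 → R3} (hg : LocallyIntegrable g volume)
    {r s : ℝ} (hr : 0 < r) {δ : ℕ → ℝ} (hδ : Tendsto δ atTop (𝓝 0)) (hδ0 : ∀ n, 0 < δ n) :
    Tendsto (fun n => ∫⁻ z in {z : R3 | ‖z‖ ∈ Icc (r - δ n) (s + δ n)},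
        ‖g z‖ₑ * ENNReal.ofReal (‖z‖ ^ (-2 : ℝ))) atTop
      (𝓝 (∫⁻ z in {z : R3 | ‖z‖ ∈ Ioc r s}, ‖g z‖ₑ * ENNReal.ofReal (‖z‖ ^ (-2 : ℝ)))) := by
  set F : R3 → ℝ≥0∞ := fun z => ‖g z‖ₑ * ENNReal.ofReal (‖z‖ ^ (-2 : ℝ)) with hF
  have hFm : AEMeasurable F := by
    have : AEStronglyMeasurable g volume := hg.aestronglyMeasurable
    exact this.enorm.mul (by fun_prop)
  set A : Set R3 := {z : R3 | ‖z‖ ∈ Icc (r / 2) (s + 1)} with hA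
  have hAm : MeasurableSet A := measurableSet_norm_mem measurableSet_Icc
  have hAc : IsCompact A := by
    refine (isCompact_closedBall (0 : R3) (s + 1)).of_isClosed_subset
      (isClosed_Icc.preimage continuous_norm) fun x hx => ?_
    simpa using hx.2
  have hfin : ∫⁻ z in A, F z ≠ ⊤ := by
    have h1 : ∫⁻ z in A, ‖g z‖ₑ < ⊤ := (hg.integrableOn_isCompact hAc).2
    have h2 : ∫⁻ z in A, F z ≤ ∫⁻ z in A, ‖g z‖ₑ * ENNReal.ofReal ((r / 2) ^ (-2 : ℝ)) := by
      refine setLIntegral_mono' hAm fun z hz => ?_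
      refine mul_le_mul_right (ENNReal.ofReal_le_ofReal ?_) _
      exact Real.rpow_le_rpow_of_nonpos (by positivity) hz.1 (by norm_num)
    rw [lintegral_mul_const' _ _ ENNReal.ofReal_ne_top] at h2
    exact (h2.trans_lt (ENNReal.mul_lt_top h1 ENNReal.ofReal_lt_top)).ne
  have hev : ∀ᶠ n in atTop, δ n < min (r / 2) 1 :=
    hδ.eventually_lt_const (by positivity)
  have hS : ∀ t : Set ℝ, MeasurableSet t → ∫⁻ z in {z : R3 | ‖z‖ ∈ t}, F z =
      ∫⁻ z, ({z : R3 | ‖z‖ ∈ t}).indicator F z := fun t ht =>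
    (lintegral_indicator (measurableSet_norm_mem ht) _).symm
  simp only [hS _ measurableSet_Icc, hS _ measurableSet_Ioc]
  refine tendsto_lintegral_filter_of_dominated_convergence' (A.indicator F) ?_ ?_ ?_ ?_
  · exact Eventually.of_forall fun n => hFm.indicator (measurableSet_norm_mem measurableSet_Icc)
  · filter_upwards [hev] with n hn
    refine Eventually.of_forall fun z => indicator_le_indicator_of_subset ?_ (fun _ => zero_le) z
    intro z hz
    have h1 := hn.trans_le (min_le_left _ _)
    have h2 := hn.trans_le (min_le_right _ _)
    exact ⟨by linarith [hz.1], by linarith [hz.2]⟩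
  · rwa [lintegral_indicator hAm]
  -- The indicators converge except possibly on the inner sphere `‖z‖ = r`, which the closed annuli
  -- contain and the half-open limit does not; that sphere is null.
  · have hne : ∀ᵐ z : R3, ‖z‖ ∉ ({r} : Set ℝ) := by
      have := volume_norm_mem_eq_zero (s := {r}) (by simp)
      simpa [ae_iff] using this
    filter_upwards [hne] with z hz
    by_cases h : ‖z‖ ∈ Ioc r s
    · refine tendsto_const_nhds.congr fun n => ?_
      rw [indicator_of_mem (by exact h), indicator_of_mem]
      exact ⟨by linarith [h.1, hδ0 n], by linarith [h.2, hδ0 n]⟩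
    · have h' : ‖z‖ < r ∨ s < ‖z‖ := by
        by_contra! hcon
        exact h ⟨lt_of_le_of_ne hcon.1 fun e => hz (by simp [e]), hcon.2⟩
      rw [indicator_of_notMem (by exact h)]
      have h2 : ∀ᶠ n in atTop, ‖z‖ ∉ Icc (r - δ n) (s + δ n) := by
        rcases h' with h' | h'
        · filter_upwards [hδ.eventually_lt_const (sub_pos.2 h')] with n hn hmem
          linarith [hmem.1]
        · filter_upwards [hδ.eventually_lt_const (sub_pos.2 h')] with n hn hmem
          linarith [hmem.2]
      refine tendsto_const_nhds.congr' ?_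
      filter_upwards [h2] with n hn
      rw [indicator_of_notMem (by exact hn)]

/-- Let the mollifier shrink at radii where the mollified profiles converge. Countably many
truncations cover all positive radii, so the exceptional set stays null. The bound holds for every
pair of points of `G`, which lets later arguments pick points freely in `G`. -/
theorem exists_ae_mem_enorm_sub_le {u : R3 → ℝ} {g : R3 → R3} (hg : IsWeakGradient u g)
    (hu : IsRadial u) :
    ∃ G : Set R3, (∀ᵐ x, x ∈ G) ∧ 0 ∉ G ∧ ∀ x ∈ G, ∀ y ∈ G, ‖x‖ ≤ ‖y‖ →
      ENNReal.ofReal sphereArea * ‖u x - u y‖ₑ ≤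
        ∫⁻ z in {z : R3 | ‖z‖ ∈ Ioc ‖x‖ ‖y‖}, ‖g z‖ₑ * ENNReal.ofReal (‖z‖ ^ (-2 : ℝ)) := by
  obtain ⟨w, hw⟩ := hu
  set δ : ℕ → ℝ := fun n => 1 / ((n : ℝ) + 1) with hδ
  have hδ0 : ∀ n, 0 < δ n := fun n => by positivity
  have hδt : Tendsto δ atTop (𝓝 0) := tendsto_one_div_add_atTop_nhds_zero_nat
  -- The ratio of outer to inner radius is fixed at `2`; the differentiation theorem used below
  -- needs such a uniform bound.
  let φ : ℕ → ContDiffBump (0 : ℝ) := fun n =>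
    ⟨δ n / 2, δ n, half_pos (hδ0 n), half_lt_self (hδ0 n)⟩
  have hφ : ∀ n, (φ n).rOut = δ n := fun n => rfl
  let W : ℕ → ℝ → ℝ := fun m => (Icc (δ m) (1 / δ m)).indicator w
  have hconv : ∀ᵐ r : ℝ, ∀ m, Tendsto (fun n => ((φ n).normed volume
      ⋆[ContinuousLinearMap.lsmul ℝ ℝ, volume] W m) r) atTop (𝓝 (W m r)) := by
    rw [ae_all_iff]
    intro m
    refine ContDiffBump.ae_convolution_tendsto_right_of_locallyIntegrable (K := 2) ?_ ?_ ?_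
    · simpa only [hφ] using hδt
    · refine Eventually.of_forall fun n => ?_
      change δ n ≤ 2 * (δ n / 2)
      linarith
    · exact ((integrableOn_profile hg.locallyIntegrable hw _ (hδ0 m)).integrable_indicator
        measurableSet_Icc).locallyIntegrable
  refine ⟨{x | x ≠ 0 ∧ u x = w ‖x‖ ∧ ∀ m, Tendsto (fun n => ((φ n).normed volume
      ⋆[ContinuousLinearMap.lsmul ℝ ℝ, volume] W m) ‖x‖) atTop (𝓝 (W m ‖x‖))}, ?_, ?_, ?_⟩
  · have hne : ∀ᵐ x : R3, x ≠ 0 := by simp [ae_iff]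
    filter_upwards [hne, hw, ae_norm_of_ae hconv] with x h1 h2 h3
    exact ⟨h1, h2, h3⟩
  · simp
  · rintro x ⟨hx0, hxw, hx⟩ y ⟨hy0, hyw, hy⟩ hxy
    have hxp : 0 < ‖x‖ := norm_pos_iff.2 hx0
    -- The window `[δ m, 1 / δ m]` contains both radii with margins `‖x‖ / 2` below and `1` above,
    -- leaving room for the mollifiers.
    obtain ⟨m, hm⟩ : ∃ m, δ m < min (‖x‖ / 2) (1 / (‖y‖ + 1)) :=
      (hδt.eventually_lt_const (by positivity)).exists
    have hm1 := hm.trans_le (min_le_left _ _)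
    have hm2 : ‖y‖ + 1 < 1 / δ m := by
      rw [lt_div_iff₀ (hδ0 m), mul_comm]
      exact (lt_div_iff₀ (by positivity)).1 (hm.trans_le (min_le_right _ _))
    have hWx : W m ‖x‖ = u x := by
      rw [hxw]
      exact indicator_of_mem (show ‖x‖ ∈ Icc (δ m) (1 / δ m) from ⟨by linarith, by linarith⟩) w
    have hWy : W m ‖y‖ = u y := by
      rw [hyw]
      exact indicator_of_mem (show ‖y‖ ∈ Icc (δ m) (1 / δ m) from ⟨by linarith, by linarith⟩) w
    have hlim := ENNReal.Tendsto.const_mul (a := ENNReal.ofReal sphereArea)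
      ((hx m).sub (hy m)).enorm (Or.inr ENNReal.ofReal_ne_top)
    rw [hWx, hWy] at hlim
    refine le_of_tendsto_of_tendsto hlim
      (tendsto_setLIntegral_annulus hg.locallyIntegrable_grad (s := ‖y‖) hxp hδt hδ0) ?_
    filter_upwards [hδt.eventually_lt_const (show 0 < min (‖x‖ / 2) 1 by positivity)] with n hn
    have h1 := hn.trans_le (min_le_left _ _)
    have h2 := hn.trans_le (min_le_right _ _)
    exact enorm_convolution_sub_le hg hw (φ n) (hδ0 m) (by rw [hφ]; linarith) hxy
      (by rw [hφ]; linarith)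

/-! ### Pointwise and integral estimates -/

/-- A radial function `u`, given by its oscillation bound on the set `G` of full measure, whose
gradient `g` and Coulomb energy are controlled by `M`. -/
structure Controlled (u : R3 → ℝ) (g : R3 → R3) (G : Set R3) (M : ℝ) : Prop where
  aemeasurable : AEMeasurable u volume
  aemeasurable_grad : AEMeasurable g volume
  ae_mem : ∀ᵐ x, x ∈ G
  zero_notMem : 0 ∉ G
  enorm_sub_le : ∀ x ∈ G, ∀ y ∈ G, ‖x‖ ≤ ‖y‖ → ENNReal.ofReal sphereArea * ‖u x - u y‖ₑ ≤
    ∫⁻ z in {z : R3 | ‖z‖ ∈ Ioc ‖x‖ ‖y‖}, ‖g z‖ₑ * ENNReal.ofReal (‖z‖ ^ (-2 : ℝ))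
  nonneg : 0 ≤ M
  grad_le : ∫⁻ x, ‖g x‖ₑ ^ 2 ≤ ENNReal.ofReal (M ^ 2)
  energy_le : energy u ≤ ENNReal.ofReal (M ^ 4)

lemma sq_lintegral_mul_le {α : Type*} [MeasurableSpace α] (μ : Measure α) {f g : α → ℝ≥0∞}
    (hf : AEMeasurable f μ) (hg : AEMeasurable g μ) :
    (∫⁻ x, f x * g x ∂μ) ^ 2 ≤ (∫⁻ x, f x ^ 2 ∂μ) * ∫⁻ x, g x ^ 2 ∂μ := by
  have h := ENNReal.lintegral_mul_le_Lp_mul_Lq μ Real.HolderConjugate.two_two hf hg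
  simp only [Pi.mul_apply, ENNReal.rpow_two] at h
  calc _ ≤ ((∫⁻ x, f x ^ 2 ∂μ) ^ (1 / 2 : ℝ) * (∫⁻ x, g x ^ 2 ∂μ) ^ (1 / 2 : ℝ)) ^ 2 := by gcongr
    _ = _ := by
      rw [mul_pow, ← ENNReal.rpow_two, ← ENNReal.rpow_two, ← ENNReal.rpow_mul, ← ENNReal.rpow_mul]
      norm_num

lemma ofReal_rpow_sq {t : ℝ} (ht : 0 ≤ t) (a : ℝ) :
    ENNReal.ofReal (t ^ a) ^ 2 = ENNReal.ofReal (t ^ (a * 2)) := by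
  rw [← ENNReal.ofReal_pow (Real.rpow_nonneg ht _), Real.rpow_mul ht, Real.rpow_two]

/-- On the annulus `‖x - y‖ ≤ 4R`, so with `m` the mass of `u²` there the energy is at least `m² /
(4R)`. -/
lemma lintegral_sq_le_of_energy_le {u : R3 → ℝ} {M : ℝ}
    (h : energy u ≤ ENNReal.ofReal (M ^ 4)) {R : ℝ} (hR : 0 < R) :
    ∫⁻ x in {x : R3 | ‖x‖ ∈ Ioc R (2 * R)}, ‖u x‖ₑ ^ 2 ≤ ENNReal.ofReal (2 * √R * M ^ 2) := by
  set A : Set R3 := {x : R3 | ‖x‖ ∈ Ioc R (2 * R)} with hA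
  have hAm : MeasurableSet A := measurableSet_norm_mem measurableSet_Ioc
  set m := ∫⁻ x in A, ‖u x‖ₑ ^ 2 with hm
  have hpt : ∀ x ∈ A, ‖u x‖ₑ ^ 2 * (m * ENNReal.ofReal (1 / (4 * R))) ≤
      ∫⁻ y, ENNReal.ofReal (u x ^ 2 * u y ^ 2 / ‖x - y‖) := by
    intro x hx
    have hfin : ‖u x‖ₑ ^ 2 ≠ ⊤ := by simp
    rw [hm, ← lintegral_mul_const' _ _ ENNReal.ofReal_ne_top, ← lintegral_const_mul' _ _ hfin]
    refine le_trans ?_ (setLIntegral_le_lintegral A _)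
    refine lintegral_mono_ae ?_
    have hne : ∀ᵐ y : R3, y ≠ x := by simp [ae_iff]
    filter_upwards [ae_restrict_mem hAm, ae_restrict_of_ae hne] with y hy hyx
    have hpos : 0 < ‖x - y‖ := norm_pos_iff.2 (sub_ne_zero.2 (Ne.symm hyx))
    have hle : ‖x - y‖ ≤ 4 * R := by
      have := norm_sub_le x y
      linarith [hx.2, hy.2]
    rw [← ofReal_norm, ← ofReal_norm, ← ENNReal.ofReal_pow (norm_nonneg _),
      ← ENNReal.ofReal_pow (norm_nonneg _), ← ENNReal.ofReal_mul (by positivity),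
      ← ENNReal.ofReal_mul (by positivity)]
    refine ENNReal.ofReal_le_ofReal ?_
    rw [Real.norm_eq_abs, Real.norm_eq_abs, sq_abs, sq_abs, ← mul_assoc, mul_one_div]
    gcongr
  have h1 : m * (m * ENNReal.ofReal (1 / (4 * R))) ≤ ENNReal.ofReal (M ^ 4) := by
    refine le_trans ?_ h
    -- An infinite `m` cannot be pulled out of the integral as a constant; in that case the
    -- integrand `‖u x‖² · ⊤` dominates `‖u x‖²`, whose integral is already infinite.
    by_cases hmt : m = ⊤
    · refine le_trans ?_ (setLIntegral_le_lintegral A _)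
      have h2 : ENNReal.ofReal (1 / (4 * R)) ≠ 0 := by
        rw [Ne, ENNReal.ofReal_eq_zero, not_le]; positivity
      refine le_trans ?_ (setLIntegral_mono' hAm hpt)
      rw [hmt, ENNReal.top_mul h2]
      refine le_trans ?_ (lintegral_mono (f := fun x => (1 : ℝ≥0∞) * ‖u x‖ₑ ^ 2) ?_)
      · simp only [one_mul]
        rw [← hm, hmt]; exact le_top
      · intro x
        simp only [mul_comm (1 : ℝ≥0∞)]
        gcongr
        exact le_top
    · rw [hm, ← lintegral_mul_const' _ _ (ENNReal.mul_ne_top hmt ENNReal.ofReal_ne_top)]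
      exact (setLIntegral_mono' hAm hpt).trans (setLIntegral_le_lintegral A _)
  have h2 : m ^ 2 ≤ ENNReal.ofReal (2 * √R * M ^ 2) ^ 2 := by
    calc m ^ 2 = m * (m * ENNReal.ofReal (1 / (4 * R))) * ENNReal.ofReal (4 * R) := by
          rw [mul_assoc, mul_assoc, ← ENNReal.ofReal_mul (by positivity), one_div,
            inv_mul_cancel₀ (by positivity), ENNReal.ofReal_one, mul_one, sq]
      _ ≤ ENNReal.ofReal (M ^ 4) * ENNReal.ofReal (4 * R) := by gcongr
      _ = _ := by
        rw [← ENNReal.ofReal_mul (by positivity), ← ENNReal.ofReal_pow (by positivity)]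
        congr 1
        rw [mul_pow, mul_pow, Real.sq_sqrt hR.le]
        ring
  exact (ENNReal.pow_le_pow_left_iff two_ne_zero).1 h2

/-- The constant in the pointwise bounds. -/
noncomputable def pointwiseConst : ℝ := 4 / √sphereArea

lemma pointwiseConst_pos : 0 < pointwiseConst := by
  have := sphereArea_pos
  unfold pointwiseConst
  positivity

namespace Controlled

variable {u : R3 → ℝ} {g : R3 → R3} {G : Set R3} {M : ℝ}

/-- Cauchy–Schwarz on the annulus separates the gradient from the weight; one of the two factors
`sphereArea` on the left cancels against the integral of the weight. -/
lemma sq_sub_le (h : Controlled u g G M) {x y : R3} (hx : x ∈ G) (hy : y ∈ G)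
    (hxy : ‖x‖ ≤ ‖y‖) : sphereArea * (u x - u y) ^ 2 ≤ M ^ 2 * (1 / ‖x‖ - 1 / ‖y‖) := by
  have hκ := sphereArea_pos
  have hxp : 0 < ‖x‖ := norm_pos_iff.2 fun e => h.zero_notMem (e ▸ hx)
  have hd : 0 ≤ 1 / ‖x‖ - 1 / ‖y‖ := sub_nonneg.2 (one_div_le_one_div_of_le hxp hxy)
  have h1 : (ENNReal.ofReal sphereArea * ‖u x - u y‖ₑ) ^ 2 ≤
      ENNReal.ofReal (M ^ 2) * ENNReal.ofReal (sphereArea * (1 / ‖x‖ - 1 / ‖y‖)) := by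
    calc _ ≤ (∫⁻ z in {z : R3 | ‖z‖ ∈ Ioc ‖x‖ ‖y‖},
          ‖g z‖ₑ * ENNReal.ofReal (‖z‖ ^ (-2 : ℝ))) ^ 2 := by
            gcongr; exact h.enorm_sub_le x hx y hy hxy
      _ ≤ (∫⁻ z in {z : R3 | ‖z‖ ∈ Ioc ‖x‖ ‖y‖}, ‖g z‖ₑ ^ 2) *
          ∫⁻ z in {z : R3 | ‖z‖ ∈ Ioc ‖x‖ ‖y‖}, ENNReal.ofReal (‖z‖ ^ (-2 : ℝ)) ^ 2 :=
        sq_lintegral_mul_le _ h.aemeasurable_grad.restrict.enorm (by fun_prop)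
      _ ≤ _ := by
        refine mul_le_mul' ((setLIntegral_le_lintegral _ _).trans h.grad_le) (le_of_eq ?_)
        rw [← setLIntegral_norm_rpow_neg_four hxp hxy]
        refine lintegral_congr fun z => ?_
        rw [ofReal_rpow_sq (norm_nonneg _)]
        norm_num
  rw [← ofReal_norm, ← ENNReal.ofReal_mul hκ.le, ← ENNReal.ofReal_pow (by positivity),
    ← ENNReal.ofReal_mul (by positivity), ENNReal.ofReal_le_ofReal_iff (by positivity),
    mul_pow, Real.norm_eq_abs, sq_abs] at h1
  have h2 : sphereArea * (sphereArea * (u x - u y) ^ 2) ≤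
      sphereArea * (M ^ 2 * (1 / ‖x‖ - 1 / ‖y‖)) := by nlinarith
  exact le_of_mul_le_mul_left h2 hκ

/-- Some point of `G` in the shell lies at or below the mean of `u²`. The shell sits in the dyadic
annulus because `l ≤ r`, which bounds its mass, and its volume is at least `sphereArea * (r ^ 2 *
l)`. -/
lemma exists_sq_le (h : Controlled u g G M) {r l : ℝ} (hr : 0 < r) (hl : 0 < l) (hlr : l ≤ r) :
    ∃ y ∈ G, ‖y‖ ∈ Ioc r (r + l) ∧ sphereArea * (r ^ 2 * l) * u y ^ 2 ≤ 2 * √r * M ^ 2 := by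
  have hκ := sphereArea_pos
  set S : Set R3 := {x : R3 | ‖x‖ ∈ Ioc r (r + l)} with hS
  have hSm : MeasurableSet S := measurableSet_norm_mem measurableSet_Ioc
  have hvol := volume_norm_mem_Ioc hr.le (by linarith : r ≤ r + l)
  have hc : r ^ 2 * l ≤ ((r + l) ^ 3 - r ^ 3) / 3 := by nlinarith [mul_pos hr hl, pow_pos hl 3]
  have hvle : ENNReal.ofReal (sphereArea * (r ^ 2 * l)) ≤ volume S := by
    rw [hS, hvol]
    exact ENNReal.ofReal_le_ofReal (mul_le_mul_of_nonneg_left hc hκ.le)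
  have hv0 : volume S ≠ 0 := by
    refine (lt_of_lt_of_le ?_ hvle).ne'
    rw [ENNReal.ofReal_pos]; positivity
  have hvt : volume S ≠ ⊤ := by rw [hS, hvol]; exact ENNReal.ofReal_ne_top
  have : IsFiniteMeasure (volume.restrict S) := ⟨by simpa using hvt.lt_top⟩
  have hnull : (volume.restrict S) (Gᶜ ∪ Sᶜ) = 0 := by
    refine measure_union_null ?_ ?_
    · exact ae_restrict_of_ae h.ae_mem
    · exact ae_restrict_mem hSm
  obtain ⟨y, hy, hle⟩ := exists_notMem_null_le_laverage
    (f := fun x => ‖u x‖ₑ ^ 2) (μ := volume.restrict S) (by simpa using hv0)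
    (h.aemeasurable.restrict.enorm.pow_const 2) hnull
  simp only [mem_union, mem_compl_iff, not_or, not_not] at hy
  refine ⟨y, hy.1, hy.2, ?_⟩
  rw [setLAverage_eq, ENNReal.le_div_iff_mul_le (Or.inl hv0) (Or.inl hvt)] at hle
  have h3 : ∫⁻ x in S, ‖u x‖ₑ ^ 2 ≤ ENNReal.ofReal (2 * √r * M ^ 2) := by
    refine le_trans (lintegral_mono_set fun x hx => ?_)
      (lintegral_sq_le_of_energy_le h.energy_le hr)
    exact ⟨hx.1, hx.2.trans (by linarith)⟩
  have h4 : ENNReal.ofReal (sphereArea * (r ^ 2 * l)) * ‖u y‖ₑ ^ 2 ≤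
      ENNReal.ofReal (2 * √r * M ^ 2) := by
    rw [mul_comm]
    exact (mul_le_mul_right hvle _).trans (hle.trans h3)
  rw [← ofReal_norm, ← ENNReal.ofReal_pow (norm_nonneg _), ← ENNReal.ofReal_mul (by positivity),
    ENNReal.ofReal_le_ofReal_iff (by positivity), Real.norm_eq_abs, sq_abs] at h4
  exact h4

/-- Compare `x` with a good point of the shell just outside it: the oscillation costs `l / ‖x‖ ^ 2`,
the value at the good point `√‖x‖ / (‖x‖ ^ 2 * l)`. The thickness is left free to be optimized. -/
lemma sq_le (h : Controlled u g G M) {x : R3} (hx : x ∈ G) {l : ℝ} (hl : 0 < l)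
    (hlx : l ≤ ‖x‖) :
    sphereArea * u x ^ 2 ≤
      M ^ 2 * (2 * (l / ‖x‖ ^ 2) + 4 * (√‖x‖ / (‖x‖ ^ 2 * l))) := by
  have hκ := sphereArea_pos
  have hr : 0 < ‖x‖ := hl.trans_le hlx
  obtain ⟨y, hyG, hy, hle⟩ := h.exists_sq_le hr hl hlx
  have h1 := h.sq_sub_le hx hyG hy.1.le
  have h2 : 1 / ‖x‖ - 1 / ‖y‖ ≤ l / ‖x‖ ^ 2 := by
    have hyp : 0 < ‖y‖ := hr.trans hy.1
    rw [div_sub_div _ _ hr.ne' hyp.ne', div_le_div_iff₀ (by positivity) (by positivity)]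
    have h3 : ‖y‖ - ‖x‖ ≤ l := by linarith [hy.2]
    have h4 : ‖x‖ ^ 2 ≤ ‖x‖ * ‖y‖ := by nlinarith [hy.1]
    have h5 : 0 ≤ ‖y‖ - ‖x‖ := by linarith [hy.1]
    nlinarith
  have h3 : sphereArea * u y ^ 2 ≤ M ^ 2 * (2 * (√‖x‖ / (‖x‖ ^ 2 * l))) := by
    rw [show M ^ 2 * (2 * (√‖x‖ / (‖x‖ ^ 2 * l))) = (2 * √‖x‖ * M ^ 2) / (‖x‖ ^ 2 * l) by ring,
      le_div_iff₀ (by positivity)]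
    linarith
  have h4 : M ^ 2 * (1 / ‖x‖ - 1 / ‖y‖) ≤ M ^ 2 * (l / ‖x‖ ^ 2) := by gcongr
  have h5 : u x ^ 2 ≤ 2 * (u x - u y) ^ 2 + 2 * u y ^ 2 := by nlinarith [sq_nonneg (u x - 2 * u y)]
  nlinarith

/-- The thickness `‖x‖ ^ (1/4)` balances the two costs, both becoming `‖x‖ ^ (-7/4)`; it is
admissible since `‖x‖ ≥ 1`. -/
lemma abs_le_of_one_le (h : Controlled u g G M) {x : R3} (hx : x ∈ G) (h1 : 1 ≤ ‖x‖) :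
    |u x| ≤ pointwiseConst * M * ‖x‖ ^ (-7 / 8 : ℝ) := by
  have hκ := sphereArea_pos
  have hM := h.nonneg
  have hr : 0 < ‖x‖ := by linarith
  have hl : ‖x‖ ^ (1 / 4 : ℝ) ≤ ‖x‖ := by
    simpa using Real.rpow_le_rpow_of_exponent_le h1 (by norm_num : (1 / 4 : ℝ) ≤ 1)
  have h2 := h.sq_le hx (by positivity) hl
  have e1 : ‖x‖ ^ (1 / 4 : ℝ) / ‖x‖ ^ 2 = ‖x‖ ^ (-7 / 4 : ℝ) := by
    rw [← Real.rpow_two, ← Real.rpow_sub hr]; norm_num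
  have e2 : √‖x‖ / (‖x‖ ^ 2 * ‖x‖ ^ (1 / 4 : ℝ)) = ‖x‖ ^ (-7 / 4 : ℝ) := by
    rw [Real.sqrt_eq_rpow, ← Real.rpow_two, ← Real.rpow_add hr, ← Real.rpow_sub hr]; norm_num
  have e3 : (‖x‖ ^ (-7 / 8 : ℝ)) ^ 2 = ‖x‖ ^ (-7 / 4 : ℝ) := by
    rw [← Real.rpow_two, ← Real.rpow_mul hr.le]; norm_num
  rw [e1, e2] at h2
  have hK := pointwiseConst_pos
  refine abs_le_of_sq_le_sq ?_ (by positivity)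
  rw [mul_pow, mul_pow, e3, pointwiseConst, div_pow, Real.sq_sqrt hκ.le]
  rw [show (4 ^ 2 / sphereArea * M ^ 2 * ‖x‖ ^ (-7 / 4 : ℝ)) =
    (16 * M ^ 2 * ‖x‖ ^ (-7 / 4 : ℝ)) / sphereArea by ring, le_div_iff₀ hκ]
  -- The two terms add up to `6`, within the `16` provided by the square of `4` in `pointwiseConst`.
  have : 0 ≤ M ^ 2 * ‖x‖ ^ (-7 / 4 : ℝ) := by positivity
  nlinarith

/-- Near the unit sphere there is a point of `G` with a good bound. -/
lemma exists_reference (h : Controlled u g G M) :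
    ∃ y ∈ G, 1 < ‖y‖ ∧ sphereArea * u y ^ 2 ≤ 2 * M ^ 2 := by
  obtain ⟨y, hyG, hy, hle⟩ := h.exists_sq_le one_pos one_pos le_rfl
  exact ⟨y, hyG, hy.1, by simpa using hle⟩

/-- The oscillation up to a reference point just outside the unit sphere costs at most `M ^ 2 /
‖x‖`, which for `‖x‖ ≤ 1` also absorbs the value there. -/
lemma abs_le_of_le_one (h : Controlled u g G M) {x : R3} (hx : x ∈ G) (h1 : ‖x‖ ≤ 1) :
    |u x| ≤ pointwiseConst * M * ‖x‖ ^ (-1 / 2 : ℝ) := by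
  have hκ := sphereArea_pos
  have hM := h.nonneg
  have hr : 0 < ‖x‖ := norm_pos_iff.2 fun e => h.zero_notMem (e ▸ hx)
  obtain ⟨y, hyG, hy, hle⟩ := h.exists_reference
  have h2 := h.sq_sub_le hx hyG (h1.trans hy.le)
  have e3 : (‖x‖ ^ (-1 / 2 : ℝ)) ^ 2 = 1 / ‖x‖ := by
    rw [← Real.rpow_two, ← Real.rpow_mul hr.le, one_div, ← Real.rpow_neg_one]; norm_num
  have hK := pointwiseConst_pos
  refine abs_le_of_sq_le_sq ?_ (by positivity)
  rw [mul_pow, mul_pow, e3, pointwiseConst, div_pow, Real.sq_sqrt hκ.le]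
  rw [show (4 ^ 2 / sphereArea * M ^ 2 * (1 / ‖x‖)) =
    (16 * M ^ 2 * (1 / ‖x‖)) / sphereArea by ring, le_div_iff₀ hκ]
  have h3 : 1 ≤ 1 / ‖x‖ := by rwa [le_div_iff₀ hr, one_mul]
  have h4 : 0 ≤ 1 / ‖y‖ := by positivity
  have h5 : M ^ 2 * (1 / ‖x‖ - 1 / ‖y‖) ≤ M ^ 2 * (1 / ‖x‖) := by gcongr; linarith
  have h6 : M ^ 2 * 1 ≤ M ^ 2 * (1 / ‖x‖) := by gcongr
  have h7 : u x ^ 2 ≤ 2 * (u x - u y) ^ 2 + 2 * u y ^ 2 := by nlinarith [sq_nonneg (u x - 2 * u y)]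
  nlinarith

/-! ### Integrals of powers of `u` outside and inside the unit ball. -/

lemma enorm_le_of_one_le (h : Controlled u g G M) {x : R3} (hx : x ∈ G) (h1 : 1 ≤ ‖x‖) :
    ‖u x‖ₑ ≤ ENNReal.ofReal (pointwiseConst * M * ‖x‖ ^ (-7 / 8 : ℝ)) := by
  rw [← ofReal_norm]
  exact ENNReal.ofReal_le_ofReal (h.abs_le_of_one_le hx h1)

lemma enorm_le_of_le_one (h : Controlled u g G M) {x : R3} (hx : x ∈ G) (h1 : ‖x‖ ≤ 1) :
    ‖u x‖ₑ ≤ ENNReal.ofReal (pointwiseConst * M * ‖x‖ ^ (-1 / 2 : ℝ)) := by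
  rw [← ofReal_norm]
  exact ENNReal.ofReal_le_ofReal (h.abs_le_of_le_one hx h1)

/-- Bound `p - 2` powers of `u` by their supremum, of order `2 ^ (-7k/8)` each, and leave `u²` to
the energy, which gives `2 ^ (k/2)`. -/
lemma lintegral_dyadic_le (h : Controlled u g G M) {p : ℝ} (hp : 2 < p) (k : ℕ) :
    ∫⁻ x in {x : R3 | ‖x‖ ∈ Ioc ((2 : ℝ) ^ k) (2 * 2 ^ k)}, ‖u x‖ₑ ^ p ≤
      ENNReal.ofReal (2 * pointwiseConst ^ (p - 2) * M ^ p *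
        ((2 : ℝ) ^ (1 / 2 - 7 / 8 * (p - 2))) ^ k) := by
  have hK := pointwiseConst_pos
  have hM := h.nonneg
  have h2k : (0 : ℝ) < 2 ^ k := by positivity
  have hAm := measurableSet_norm_mem (measurableSet_Ioc (a := (2 : ℝ) ^ k) (b := 2 * 2 ^ k))
  set c : ℝ := pointwiseConst * M * ((2 : ℝ) ^ k) ^ (-7 / 8 : ℝ) with hc
  have hc0 : 0 ≤ c := by positivity
  calc ∫⁻ x in {x : R3 | ‖x‖ ∈ Ioc ((2 : ℝ) ^ k) (2 * 2 ^ k)}, ‖u x‖ₑ ^ p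
      ≤ ∫⁻ x in {x : R3 | ‖x‖ ∈ Ioc ((2 : ℝ) ^ k) (2 * 2 ^ k)},
          ENNReal.ofReal (c ^ (p - 2)) * ‖u x‖ₑ ^ 2 := by
        refine lintegral_mono_ae ?_
        filter_upwards [ae_restrict_mem hAm, ae_restrict_of_ae h.ae_mem] with x hx hxG
        have hx1 : (2 : ℝ) ^ k ≤ ‖x‖ := hx.1.le
        have h1 : ‖u x‖ₑ ≤ ENNReal.ofReal c := by
          refine (h.enorm_le_of_one_le hxG ((one_le_pow₀ (by norm_num)).trans hx1)).trans
            (ENNReal.ofReal_le_ofReal ?_)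
          rw [hc]
          exact mul_le_mul_of_nonneg_left
            (Real.rpow_le_rpow_of_nonpos h2k hx1 (by norm_num)) (by positivity)
        rw [← ENNReal.ofReal_rpow_of_nonneg hc0 (by linarith)]
        calc ‖u x‖ₑ ^ p = ‖u x‖ₑ ^ (p - 2) * ‖u x‖ₑ ^ 2 := by
              rw [← ENNReal.rpow_two, ← ENNReal.rpow_add_of_nonneg _ _ (by linarith) (by norm_num)]
              ring_nf
          _ ≤ _ := by
              gcongr
    _ ≤ ENNReal.ofReal (c ^ (p - 2)) * ENNReal.ofReal (2 * √(2 ^ k) * M ^ 2) := by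
        rw [lintegral_const_mul' _ _ ENNReal.ofReal_ne_top]
        gcongr
        exact lintegral_sq_le_of_energy_le h.energy_le h2k
    _ = _ := by
        rw [← ENNReal.ofReal_mul (by positivity)]
        congr 1
        have e1 : M ^ p = M ^ (p - 2) * M ^ 2 := by
          rw [← Real.rpow_two, ← Real.rpow_add_of_nonneg hM (by linarith) (by norm_num)]
          ring_nf
        have e2 : ((2 : ℝ) ^ (1 / 2 - 7 / 8 * (p - 2))) ^ k =
            (((2 : ℝ) ^ k) ^ (-7 / 8 : ℝ)) ^ (p - 2) * √(2 ^ k) := by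
          rw [Real.sqrt_eq_rpow, ← Real.rpow_mul h2k.le, ← Real.rpow_add h2k,
            ← Real.rpow_natCast, ← Real.rpow_mul (by norm_num), ← Real.rpow_natCast 2 k,
            ← Real.rpow_mul (by norm_num)]
          ring_nf
        rw [hc, Real.mul_rpow (by positivity) (by positivity), Real.mul_rpow (by positivity) hM,
          e1, e2]
        ring

/-- The ratio `2 ^ (1/2 - 7/8 (p - 2))` of the dyadic series is less than `1` exactly for `p >
18/7`. -/
lemma lintegral_exterior_le (h : Controlled u g G M) {p : ℝ} (hp : 18 / 7 < p) :
    ∫⁻ x in {x : R3 | ‖x‖ ∈ Ioi 1}, ‖u x‖ₑ ^ p ≤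
      ENNReal.ofReal (2 * pointwiseConst ^ (p - 2) *
        (1 - (2 : ℝ) ^ (1 / 2 - 7 / 8 * (p - 2)))⁻¹ * M ^ p) := by
  have hK := pointwiseConst_pos
  have hM := h.nonneg
  set q : ℝ := (2 : ℝ) ^ (1 / 2 - 7 / 8 * (p - 2)) with hq
  have hq0 : 0 < q := by positivity
  have hq1 : q < 1 := Real.rpow_lt_one_of_one_lt_of_neg (by norm_num) (by linarith)
  have hsub : {x : R3 | ‖x‖ ∈ Ioi 1} ⊆
      ⋃ k : ℕ, {x : R3 | ‖x‖ ∈ Ioc ((2 : ℝ) ^ k) (2 * 2 ^ k)} := by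
    intro x hx
    have hx1 : 1 < ‖x‖ := hx
    obtain ⟨k, hk1, hk2⟩ := exists_nat_pow_near hx1.le (one_lt_two (α := ℝ))
    rw [pow_succ'] at hk2
    -- A radius equal to a power of two belongs to the preceding half-open annulus; the power `1`
    -- itself is excluded by strictness.
    rcases hk1.eq_or_lt with he | hlt
    · rcases k with _ | k
      · simp only [pow_zero] at he
        linarith
      · rw [pow_succ'] at he
        have : (0 : ℝ) < 2 ^ k := by positivity
        exact mem_iUnion.2 ⟨k, show _ < _ by linarith, he.ge⟩
    · exact mem_iUnion.2 ⟨k, hlt, hk2.le⟩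
  calc _ ≤ ∑' k : ℕ, ∫⁻ x in {x : R3 | ‖x‖ ∈ Ioc ((2 : ℝ) ^ k) (2 * 2 ^ k)}, ‖u x‖ₑ ^ p :=
        (lintegral_mono_set hsub).trans (lintegral_iUnion_le _ _)
    _ ≤ ∑' k : ℕ, ENNReal.ofReal (2 * pointwiseConst ^ (p - 2) * M ^ p * q ^ k) :=
        ENNReal.tsum_le_tsum fun k => h.lintegral_dyadic_le (by linarith) k
    _ = _ := by
        rw [← ENNReal.ofReal_tsum_of_nonneg (fun k => by positivity)
          ((summable_geometric_of_lt_one hq0.le hq1).mul_left _), tsum_mul_left,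
          tsum_geometric_of_lt_one hq0.le hq1]
        ring_nf

lemma lintegral_ball_le (h : Controlled u g G M) {p : ℝ} (hp0 : 0 < p) (hp : p < 6) :
    ∫⁻ x in {x : R3 | ‖x‖ ∈ Ioc 0 1}, ‖u x‖ₑ ^ p ≤
      ENNReal.ofReal (pointwiseConst ^ p * (sphereArea / (3 - p / 2)) * M ^ p) := by
  have hK := pointwiseConst_pos
  have hM := h.nonneg
  have hκ := sphereArea_pos
  calc _ ≤ ∫⁻ x in {x : R3 | ‖x‖ ∈ Ioc 0 1},
        ENNReal.ofReal ((pointwiseConst * M) ^ p) * ENNReal.ofReal (‖x‖ ^ (-p / 2)) := by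
        refine lintegral_mono_ae ?_
        filter_upwards [ae_restrict_mem (measurableSet_norm_mem measurableSet_Ioc),
          ae_restrict_of_ae h.ae_mem] with x hx hxG
        calc ‖u x‖ₑ ^ p ≤ ENNReal.ofReal (pointwiseConst * M * ‖x‖ ^ (-1 / 2 : ℝ)) ^ p := by
              gcongr; exact h.enorm_le_of_le_one hxG hx.2
          _ = _ := by
              rw [ENNReal.ofReal_rpow_of_nonneg (by positivity) hp0.le,
                ← ENNReal.ofReal_mul (by positivity), Real.mul_rpow (by positivity)
                (by positivity), ← Real.rpow_mul (norm_nonneg _)]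
              ring_nf
    _ = _ := by
        rw [lintegral_const_mul' _ _ ENNReal.ofReal_ne_top,
          setLIntegral_norm_rpow_Ioc (by linarith) zero_le_one,
          ← ENNReal.ofReal_mul (by positivity), Real.mul_rpow hK.le hM, Real.one_rpow]
        congr 1
        rw [show 3 + -p / 2 = 3 - p / 2 by ring]
        ring

/-- Hardy's inequality for the oscillation of a radial function. -/
lemma lintegral_norm_rpow_mul_sq_sub_le (h : Controlled u g G M) {y : R3} (hy : y ∈ G)
    (hy1 : 1 < ‖y‖) :
    ENNReal.ofReal (sphereArea ^ 2) *
      ∫⁻ x in {x : R3 | ‖x‖ ∈ Ioc 0 1}, ENNReal.ofReal (‖x‖ ^ (-2 : ℝ)) * ‖u x - u y‖ₑ ^ 2 ≤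
      ENNReal.ofReal (4 * sphereArea ^ 2 * M ^ 2) := by
  have hκ := sphereArea_pos
  have hBm := measurableSet_norm_mem (measurableSet_Ioc (a := (0 : ℝ)) (b := 1))
  set E : R3 → R3 → ℝ≥0∞ := fun x z => ({z : R3 | ‖z‖ ∈ Ioi ‖x‖}).indicator
    (fun z => ‖g z‖ₑ ^ 2 * ENNReal.ofReal (‖z‖ ^ (-1 / 2 : ℝ))) z with hE
  -- The weight is split as `‖z‖ ^ (-1/4) * ‖z‖ ^ (-7/4)` before Cauchy–Schwarz. The second factor
  -- integrates to a multiple of `‖x‖ ^ (-1/2)`; together with `‖x‖ ^ (-2)` this is `‖x‖ ^ (-5/2)`,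
  -- whose integral over `‖x‖ ≤ ‖z‖` cancels the remaining `‖z‖ ^ (-1/2)` after Tonelli.
  have hpt : ∀ x ∈ G, ‖x‖ ∈ Ioc 0 1 → ENNReal.ofReal (sphereArea ^ 2) * ‖u x - u y‖ₑ ^ 2 ≤
      (∫⁻ z, E x z) * ENNReal.ofReal (2 * sphereArea * ‖x‖ ^ (-1 / 2 : ℝ)) := by
    intro x hx hx1
    have hSm := measurableSet_norm_mem (measurableSet_Ioi (a := ‖x‖))
    calc _ = (ENNReal.ofReal sphereArea * ‖u x - u y‖ₑ) ^ 2 := by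
          rw [mul_pow, ENNReal.ofReal_pow hκ.le]
      _ ≤ (∫⁻ z in {z : R3 | ‖z‖ ∈ Ioi ‖x‖}, (‖g z‖ₑ * ENNReal.ofReal (‖z‖ ^ (-1 / 4 : ℝ))) *
            ENNReal.ofReal (‖z‖ ^ (-7 / 4 : ℝ))) ^ 2 := by
          gcongr
          refine (h.enorm_sub_le x hx y hy (hx1.2.trans hy1.le)).trans ?_
          refine (lintegral_mono_set (t := {z : R3 | ‖z‖ ∈ Ioi ‖x‖}) fun z hz => hz.1).trans ?_
          refine setLIntegral_mono' hSm fun z hz => le_of_eq ?_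
          have hz0 : 0 < ‖z‖ := hx1.1.trans hz
          rw [mul_assoc, ← ENNReal.ofReal_mul (by positivity), ← Real.rpow_add hz0]
          norm_num
      _ ≤ (∫⁻ z in {z : R3 | ‖z‖ ∈ Ioi ‖x‖}, (‖g z‖ₑ * ENNReal.ofReal (‖z‖ ^ (-1 / 4 : ℝ))) ^ 2) *
            ∫⁻ z in {z : R3 | ‖z‖ ∈ Ioi ‖x‖}, ENNReal.ofReal (‖z‖ ^ (-7 / 4 : ℝ)) ^ 2 :=
          sq_lintegral_mul_le _ (h.aemeasurable_grad.restrict.enorm.mul (by fun_prop))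
            (by fun_prop)
      _ = _ := by
          congr 1
          · rw [← lintegral_indicator hSm]
            refine lintegral_congr fun z => ?_
            simp only [hE, indicator]
            split_ifs
            · rw [mul_pow, ofReal_rpow_sq (norm_nonneg _)]
              norm_num
            · rfl
          · simp_rw [ofReal_rpow_sq (norm_nonneg _)]
            rw [setLIntegral_norm_rpow_Ioi (by norm_num) hx1.1]
            norm_num
            ring_nf
  have hEm : AEMeasurable (Function.uncurry fun x z : R3 =>
      ENNReal.ofReal (‖x‖ ^ (-5 / 2 : ℝ)) * E x z)
      ((volume.restrict {x : R3 | ‖x‖ ∈ Ioc 0 1}).prod volume) := by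
    have h1 : Function.uncurry (fun x z : R3 => ENNReal.ofReal (‖x‖ ^ (-5 / 2 : ℝ)) * E x z) =
        fun q : R3 × R3 => ENNReal.ofReal (‖q.1‖ ^ (-5 / 2 : ℝ)) *
          ({q : R3 × R3 | ‖q.1‖ < ‖q.2‖}).indicator
            (fun q => ‖g q.2‖ₑ ^ 2 * ENNReal.ofReal (‖q.2‖ ^ (-1 / 2 : ℝ))) q := by
      ext q
      simp [hE, Function.uncurry, indicator]
    rw [h1]
    have hgm : AEMeasurable (fun q : R3 × R3 => g q.2)
        ((volume.restrict {x : R3 | ‖x‖ ∈ Ioc 0 1}).prod volume) :=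
      h.aemeasurable_grad.comp_snd
    refine AEMeasurable.mul (by fun_prop) (AEMeasurable.indicator ?_ ?_)
    · exact (hgm.enorm.pow_const 2).mul (by fun_prop)
    · exact measurableSet_lt (by fun_prop) (by fun_prop)
  calc _ = ∫⁻ x in {x : R3 | ‖x‖ ∈ Ioc 0 1}, ENNReal.ofReal (‖x‖ ^ (-2 : ℝ)) *
          (ENNReal.ofReal (sphereArea ^ 2) * ‖u x - u y‖ₑ ^ 2) := by
        rw [← lintegral_const_mul' _ _ ENNReal.ofReal_ne_top]
        refine lintegral_congr fun x => ?_
        ring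
    _ ≤ ∫⁻ x in {x : R3 | ‖x‖ ∈ Ioc 0 1}, ENNReal.ofReal (2 * sphereArea) *
          ∫⁻ z, ENNReal.ofReal (‖x‖ ^ (-5 / 2 : ℝ)) * E x z := by
        refine lintegral_mono_ae ?_
        filter_upwards [ae_restrict_mem hBm, ae_restrict_of_ae h.ae_mem] with x hx hxG
        rw [lintegral_const_mul' _ _ ENNReal.ofReal_ne_top]
        refine (mul_le_mul_right (hpt x hxG hx) _).trans (le_of_eq ?_)
        have hx0 : 0 < ‖x‖ := hx.1
        rw [show (-5 / 2 : ℝ) = -2 + -1 / 2 by norm_num, Real.rpow_add hx0,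
          ENNReal.ofReal_mul (by positivity), ENNReal.ofReal_mul (p := ‖x‖ ^ (-2 : ℝ))
          (by positivity)]
        ring
    _ = ENNReal.ofReal (2 * sphereArea) * ∫⁻ z, ∫⁻ x in {x : R3 | ‖x‖ ∈ Ioc 0 1},
          ENNReal.ofReal (‖x‖ ^ (-5 / 2 : ℝ)) * E x z := by
        rw [lintegral_const_mul' _ _ ENNReal.ofReal_ne_top, lintegral_lintegral_swap hEm]
    _ ≤ ENNReal.ofReal (2 * sphereArea) * ∫⁻ z, ENNReal.ofReal (2 * sphereArea) * ‖g z‖ₑ ^ 2 := by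
        refine mul_le_mul_right (lintegral_mono fun z => ?_) _
        have hZm := measurableSet_norm_mem (measurableSet_Ioc (a := (0 : ℝ)) (b := ‖z‖))
        calc _ ≤ ∫⁻ x in {x : R3 | ‖x‖ ∈ Ioc 0 ‖z‖}, ENNReal.ofReal (‖x‖ ^ (-5 / 2 : ℝ)) *
              (‖g z‖ₑ ^ 2 * ENNReal.ofReal (‖z‖ ^ (-1 / 2 : ℝ))) := by
              rw [← lintegral_indicator hBm, ← lintegral_indicator hZm]
              refine lintegral_mono fun x => ?_
              by_cases hx : x ∈ {x : R3 | ‖x‖ ∈ Ioc 0 1}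
              · rw [indicator_of_mem hx]
                by_cases hxz : ‖x‖ < ‖z‖
                · rw [indicator_of_mem (show x ∈ {x : R3 | ‖x‖ ∈ Ioc 0 ‖z‖} from ⟨hx.1, hxz.le⟩)]
                  simp [hE, indicator, hxz]
                · simp [hE, indicator, hxz]
              · rw [indicator_of_notMem hx]
                exact zero_le
          _ = ENNReal.ofReal (sphereArea * (‖z‖ ^ (1 / 2 : ℝ) / (1 / 2))) *
              (‖g z‖ₑ ^ 2 * ENNReal.ofReal (‖z‖ ^ (-1 / 2 : ℝ))) := by
              rw [lintegral_mul_const' _ _ (ENNReal.mul_ne_top (by simp) ENNReal.ofReal_ne_top),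
                setLIntegral_norm_rpow_Ioc (by norm_num) (norm_nonneg z)]
              norm_num
          _ ≤ _ := by
              rw [mul_left_comm, ← ENNReal.ofReal_mul (by positivity), mul_comm]
              refine mul_le_mul_left (ENNReal.ofReal_le_ofReal ?_) _
              rcases (norm_nonneg z).eq_or_lt with hz | hz
              · rw [← hz]; norm_num; exact hκ.le
              · have : ‖z‖ ^ (1 / 2 : ℝ) * ‖z‖ ^ (-1 / 2 : ℝ) = 1 := by
                  rw [← Real.rpow_add hz]; norm_num
                refine le_of_eq ?_
                linear_combination (2 * sphereArea) * this
    _ ≤ ENNReal.ofReal (2 * sphereArea) *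
          (ENNReal.ofReal (2 * sphereArea) * ENNReal.ofReal (M ^ 2)) := by
        rw [lintegral_const_mul' _ _ ENNReal.ofReal_ne_top]
        gcongr
        exact h.grad_le
    _ = _ := by
        rw [← ENNReal.ofReal_mul (by positivity), ← ENNReal.ofReal_mul (by positivity)]
        ring_nf

/-- The pointwise bound alone would give the non-integrable `‖x‖ ^ (-3)`. It is spent on four of the
six powers, leaving `‖x‖ ^ (-2) * u²`, which Hardy's inequality controls once the value at a
reference point is subtracted. -/
lemma lintegral_ball_six_le (h : Controlled u g G M) :
    ∫⁻ x in {x : R3 | ‖x‖ ∈ Ioc 0 1}, ‖u x‖ₑ ^ (6 : ℝ) ≤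
      ENNReal.ofReal (12 * pointwiseConst ^ 4 * M ^ (6 : ℝ)) := by
  have hK := pointwiseConst_pos
  have hM := h.nonneg
  have hκ := sphereArea_pos
  have hBm := measurableSet_norm_mem (measurableSet_Ioc (a := (0 : ℝ)) (b := 1))
  obtain ⟨y, hyG, hy, hle⟩ := h.exists_reference
  have hHardy := h.lintegral_norm_rpow_mul_sq_sub_le hyG hy
  have hHardy' : ∫⁻ x in {x : R3 | ‖x‖ ∈ Ioc 0 1},
      ENNReal.ofReal (‖x‖ ^ (-2 : ℝ)) * ‖u x - u y‖ₑ ^ 2 ≤ ENNReal.ofReal (4 * M ^ 2) := by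
    have h0 : ENNReal.ofReal (sphereArea ^ 2) ≠ 0 := by
      rw [Ne, ENNReal.ofReal_eq_zero, not_le]; positivity
    rw [← ENNReal.mul_le_mul_iff_right h0 ENNReal.ofReal_ne_top]
    refine hHardy.trans (le_of_eq ?_)
    rw [← ENNReal.ofReal_mul (by positivity)]
    ring_nf
  have hconst : ∫⁻ x in {x : R3 | ‖x‖ ∈ Ioc 0 1},
      ENNReal.ofReal (‖x‖ ^ (-2 : ℝ)) * ‖u y‖ₑ ^ 2 ≤ ENNReal.ofReal (2 * M ^ 2) := by
    rw [lintegral_mul_const' _ _ (by simp), setLIntegral_norm_rpow_Ioc (by norm_num) zero_le_one,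
      ← ofReal_norm, ← ENNReal.ofReal_pow (norm_nonneg _), ← ENNReal.ofReal_mul (by positivity)]
    refine ENNReal.ofReal_le_ofReal ?_
    rw [Real.norm_eq_abs, sq_abs]
    norm_num
    exact hle
  calc _ ≤ ∫⁻ x in {x : R3 | ‖x‖ ∈ Ioc 0 1}, ENNReal.ofReal ((pointwiseConst * M) ^ 4) *
        (2 * (ENNReal.ofReal (‖x‖ ^ (-2 : ℝ)) * ‖u x - u y‖ₑ ^ 2) +
          2 * (ENNReal.ofReal (‖x‖ ^ (-2 : ℝ)) * ‖u y‖ₑ ^ 2)) := by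
        refine lintegral_mono_ae ?_
        filter_upwards [ae_restrict_mem hBm, ae_restrict_of_ae h.ae_mem] with x hx hxG
        have h1 : ‖u x‖ₑ ^ 4 ≤ ENNReal.ofReal ((pointwiseConst * M) ^ 4) *
            ENNReal.ofReal (‖x‖ ^ (-2 : ℝ)) := by
          calc ‖u x‖ₑ ^ 4 ≤ ENNReal.ofReal (pointwiseConst * M * ‖x‖ ^ (-1 / 2 : ℝ)) ^ 4 := by
                gcongr; exact h.enorm_le_of_le_one hxG hx.2
            _ = _ := by
                rw [← ENNReal.ofReal_pow (by positivity), ← ENNReal.ofReal_mul (by positivity),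
                  mul_pow _ _ 4, ← Real.rpow_natCast (‖x‖ ^ (-1 / 2 : ℝ)),
                  ← Real.rpow_mul (norm_nonneg _)]
                norm_num
        have h2 : ‖u x‖ₑ ^ 2 ≤ 2 * ‖u x - u y‖ₑ ^ 2 + 2 * ‖u y‖ₑ ^ 2 := by
          have h3 : u x ^ 2 ≤ 2 * (u x - u y) ^ 2 + 2 * u y ^ 2 := by
            nlinarith [sq_nonneg (u x - 2 * u y)]
          have e : ∀ t : ℝ, ‖t‖ₑ ^ 2 = ENNReal.ofReal (t ^ 2) := fun t => by
            rw [← ofReal_norm, ← ENNReal.ofReal_pow (norm_nonneg _), Real.norm_eq_abs, sq_abs]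
          rw [e, e, e, show (2 : ℝ≥0∞) = ENNReal.ofReal 2 by simp,
            ← ENNReal.ofReal_mul (by norm_num), ← ENNReal.ofReal_mul (by norm_num),
            ← ENNReal.ofReal_add (by positivity) (by positivity)]
          exact ENNReal.ofReal_le_ofReal h3
        calc ‖u x‖ₑ ^ (6 : ℝ) = ‖u x‖ₑ ^ 4 * ‖u x‖ₑ ^ 2 := by
              rw [← pow_add]; norm_cast
          _ ≤ _ := mul_le_mul' h1 h2
          _ = _ := by ring
    _ ≤ ENNReal.ofReal ((pointwiseConst * M) ^ 4) *
        (2 * ENNReal.ofReal (4 * M ^ 2) + 2 * ENNReal.ofReal (2 * M ^ 2)) := by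
        rw [lintegral_const_mul' _ _ ENNReal.ofReal_ne_top, lintegral_add_right _ (by fun_prop),
          lintegral_const_mul' _ _ (by simp), lintegral_const_mul' _ _ (by simp)]
        gcongr
    _ = _ := by
        rw [show (2 : ℝ≥0∞) = ENNReal.ofReal 2 by simp,
            ← ENNReal.ofReal_mul (by norm_num), ← ENNReal.ofReal_mul (by norm_num),
            ← ENNReal.ofReal_add (by positivity) (by positivity),
            ← ENNReal.ofReal_mul (by positivity)]
        congr 1
        norm_cast
        ring

end Controlled

/-- The embedding estimate with the integral form of the `L^p` norm. -/
lemma exists_lintegral_rpow_le {p : ℝ} (hp : 18 / 7 < p) (hp6 : p ≤ 6) :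
    ∃ C : ℝ, 0 ≤ C ∧ ∀ (u : R3 → ℝ) (g : R3 → R3) (G : Set R3) (M : ℝ), Controlled u g G M →
      ∫⁻ x, ‖u x‖ₑ ^ p ≤ ENNReal.ofReal (C * M ^ p) := by
  have hK := pointwiseConst_pos
  have hκ := sphereArea_pos
  obtain ⟨C₁, hC₁, hb⟩ : ∃ C₁ : ℝ, 0 ≤ C₁ ∧ ∀ (u : R3 → ℝ) (g : R3 → R3) (G : Set R3) (M : ℝ),
      Controlled u g G M →
      ∫⁻ x in {x : R3 | ‖x‖ ∈ Ioc 0 1}, ‖u x‖ₑ ^ p ≤ ENNReal.ofReal (C₁ * M ^ p) := by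
    rcases hp6.eq_or_lt with rfl | hlt
    · exact ⟨_, by positivity, fun u g G M h => h.lintegral_ball_six_le⟩
    · refine ⟨_, ?_, fun u g G M h => h.lintegral_ball_le (by linarith) hlt⟩
      have : 0 < 3 - p / 2 := by linarith
      positivity
  have hq1 : (2 : ℝ) ^ (1 / 2 - 7 / 8 * (p - 2)) < 1 :=
    Real.rpow_lt_one_of_one_lt_of_neg (by norm_num) (by linarith)
  set C₂ : ℝ := 2 * pointwiseConst ^ (p - 2) * (1 - (2 : ℝ) ^ (1 / 2 - 7 / 8 * (p - 2)))⁻¹ with hC₂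
  have hC₂0 : 0 ≤ C₂ := by
    have : 0 < 1 - (2 : ℝ) ^ (1 / 2 - 7 / 8 * (p - 2)) := by linarith
    positivity
  refine ⟨C₁ + C₂, by positivity, fun u g G M h => ?_⟩
  have hM := h.nonneg
  have hcover : ∫⁻ x, ‖u x‖ₑ ^ p =
      ∫⁻ x in {x : R3 | ‖x‖ ∈ Ioc 0 1} ∪ {x : R3 | ‖x‖ ∈ Ioi 1}, ‖u x‖ₑ ^ p := by
    suffices hs : ({0}ᶜ : Set R3) = {x : R3 | ‖x‖ ∈ Ioc 0 1} ∪ {x : R3 | ‖x‖ ∈ Ioi 1} by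
      rw [← hs, restrict_compl_singleton]
    ext x
    have : x ≠ 0 ↔ 0 < ‖x‖ := norm_pos_iff.symm
    simp only [mem_compl_iff, mem_singleton_iff, mem_union, mem_ofPred_eq, mem_Ioc, mem_Ioi]
    rw [← Ne, this]
    constructor
    · intro hx
      rcases le_or_gt ‖x‖ 1 with h1 | h1
      · exact Or.inl ⟨hx, h1⟩
      · exact Or.inr h1
    · rintro (hx | hx)
      · exact hx.1
      · linarith
  rw [hcover]
  refine (lintegral_union_le _ _ _).trans ?_
  rw [add_mul, ENNReal.ofReal_add (by positivity) (by positivity)]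
  exact add_le_add (hb u g G M h) (h.lintegral_exterior_le hp)

/-! ### The continuous inclusion -/

lemma isWeakGradient_weakGrad {u : R3 → ℝ} (h : ∃ g, IsWeakGradient u g) :
    IsWeakGradient u (weakGrad u) := by
  unfold weakGrad
  rw [dif_pos h]
  exact h.choose_spec

lemma IsWeakGradient.ae_eq {u : R3 → ℝ} {g g' : R3 → R3} (hg : IsWeakGradient u g)
    (hg' : IsWeakGradient u g') : g =ᵐ[volume] g' := by
  have h : ∀ i, ∀ᵐ x, g x i = g' x i := by
    intro i
    refine ae_eq_of_integral_contDiff_smul_eq (hg.locallyIntegrable_grad.apply_coord i)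
      (hg'.locallyIntegrable_grad.apply_coord i) fun φ hφ hφc => ?_
    have h1 := hg.integral_eq φ hφ hφc i
    have h2 := hg'.integral_eq φ hφ hφc i
    simp only [smul_eq_mul, mul_comm (φ _)]
    linarith
  filter_upwards [ae_all_iff.2 h] with x hx
  ext i
  exact hx i

lemma normE_lt_top {u : R3 → ℝ} (hu : MemEr u) : normE u < ⊤ := by
  obtain ⟨g, hg, hg2⟩ := hu.memD12.exists_grad
  have h1 : ∫⁻ x, ‖weakGrad u x‖ₑ ^ 2 < ⊤ := by
    have h2 := lintegral_rpow_enorm_lt_top_of_eLpNorm_lt_top (by simp) (by simp) hg2.2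
    simp only [ENNReal.toReal_ofNat, ENNReal.rpow_two] at h2
    refine lt_of_eq_of_lt (lintegral_congr_ae ?_) h2
    filter_upwards [(isWeakGradient_weakGrad ⟨g, hg⟩).ae_eq hg] with x hx
    rw [hx]
  refine ENNReal.rpow_lt_top_of_nonneg (by norm_num) (ENNReal.add_lt_top.2 ⟨h1, ?_⟩).ne
  exact ENNReal.rpow_lt_top_of_nonneg (by norm_num) hu.energy_lt_top.ne

/-- The powers `M ^ 2` and `M ^ 4` undo the outer and inner square roots in `normE`. -/
lemma exists_controlled {u : R3 → ℝ} (hu : MemEr u) {M : ℝ} (hM : 0 ≤ M)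
    (h : normE u ≤ ENNReal.ofReal M) : ∃ G, Controlled u (weakGrad u) G M := by
  obtain ⟨g, hg, hg2⟩ := hu.memD12.exists_grad
  have hw := isWeakGradient_weakGrad ⟨g, hg⟩
  obtain ⟨G, hG, h0, hosc⟩ := exists_ae_mem_enorm_sub_le hw hu.radial
  have h1 : (∫⁻ x, ‖weakGrad u x‖ₑ ^ 2) + energy u ^ (1 / 2 : ℝ) ≤ ENNReal.ofReal (M ^ 2) := by
    unfold normE at h
    rw [one_div, ENNReal.rpow_inv_le_iff (by norm_num), ENNReal.rpow_two,
      ← ENNReal.ofReal_pow hM, ← one_div] at h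
    exact h
  refine ⟨G, hu.memD12.memLp_six.1.aemeasurable,
    hw.locallyIntegrable_grad.aestronglyMeasurable.aemeasurable,
    hG, h0, hosc, hM, le_self_add.trans h1, ?_⟩
  have h2 := le_add_self.trans h1
  rw [one_div, ENNReal.rpow_inv_le_iff (by norm_num), ENNReal.rpow_two,
      ← ENNReal.ofReal_pow (by positivity), ← pow_mul] at h2
  exact h2

lemma eLpNorm_le_of_lintegral_le {u : R3 → ℝ} {p : ℝ≥0∞} (hp0 : p ≠ 0) (hpt : p ≠ ⊤) {C M : ℝ}
    (hC : 0 ≤ C) (hM : 0 ≤ M)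
    (h : ∫⁻ x, ‖u x‖ₑ ^ p.toReal ≤ ENNReal.ofReal (C * M ^ p.toReal)) :
    eLpNorm u p volume ≤ ENNReal.ofReal (C ^ p.toReal⁻¹) * ENNReal.ofReal M := by
  have hp : 0 < p.toReal := ENNReal.toReal_pos hp0 hpt
  rw [eLpNorm_eq_lintegral_rpow_enorm_toReal hp0 hpt, one_div,
    ENNReal.rpow_inv_le_iff hp, ← ENNReal.ofReal_mul (by positivity),
    ENNReal.ofReal_rpow_of_nonneg (by positivity) hp.le, Real.mul_rpow (by positivity) hM,
    ← Real.rpow_mul hC, inv_mul_cancel₀ hp.ne', Real.rpow_one]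
  exact h

lemma exponent_bounds {p : ℝ≥0∞} (hp : 18 / 7 < p) (hp6 : p ≤ 6) :
    p ≠ 0 ∧ p ≠ ⊤ ∧ 18 / 7 < p.toReal ∧ p.toReal ≤ 6 := by
  have hpt : p ≠ ⊤ := (hp6.trans_lt (by simp)).ne
  refine ⟨(zero_le.trans_lt hp).ne', hpt, ?_, ?_⟩
  · have := (ENNReal.toReal_lt_toReal (hp.trans_le le_top).ne hpt).2 hp
    simpa using this
  · have := (ENNReal.toReal_le_toReal hpt (by simp)).2 hp6
    simpa using this

theorem continuous_inclusion (p : ℝ≥0∞) (hp : 18 / 7 < p) (hp6 : p ≤ 6) :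
    ∃ C : ℝ≥0, ∀ u : R3 → ℝ, MemEr u →
      MemLp u p volume ∧ eLpNorm u p volume ≤ C * normE u := by
  obtain ⟨hp0, hpt, hpr, hpr6⟩ := exponent_bounds hp hp6
  obtain ⟨C, hC, hCu⟩ := exists_lintegral_rpow_le hpr hpr6
  refine ⟨Real.toNNReal (C ^ p.toReal⁻¹), fun u hu => ?_⟩
  have hfin := normE_lt_top hu
  have hN := ENNReal.ofReal_toReal hfin.ne
  obtain ⟨G, hG⟩ := exists_controlled hu (M := (normE u).toReal) ENNReal.toReal_nonneg hN.ge
  have h := eLpNorm_le_of_lintegral_le hp0 hpt hC hG.nonneg (hCu _ _ _ _ hG)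
  rw [hN] at h
  exact ⟨⟨hu.memD12.memLp_six.1, h.trans_lt (ENNReal.mul_lt_top ENNReal.ofReal_lt_top hfin)⟩, h⟩

/-! ### The compact inclusion -/

namespace Controlled

variable {u : R3 → ℝ} {g : R3 → R3} {G : Set R3} {M : ℝ}

/-- A single profile on the whole ball of radius `R`, to serve as dominating function; `√R`
compensates the decay of `‖x‖ ^ (-1/2)` between `1` and `R`. -/
lemma abs_le_of_norm_le (h : Controlled u g G M) {x : R3} (hx : x ∈ G) {R : ℝ} (hR : 1 ≤ R)
    (hxR : ‖x‖ ≤ R) :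
    |u x| ≤ pointwiseConst * M * √R * ‖x‖ ^ (-1 / 2 : ℝ) := by
  have hK := pointwiseConst_pos
  have hM := h.nonneg
  have hr : 0 < ‖x‖ := norm_pos_iff.2 fun e => h.zero_notMem (e ▸ hx)
  have hR1 : 1 ≤ √R := Real.one_le_sqrt.2 hR
  rcases le_total ‖x‖ 1 with h1 | h1
  · refine (h.abs_le_of_le_one hx h1).trans ?_
    refine mul_le_mul_of_nonneg_right ?_ (by positivity)
    exact le_mul_of_one_le_right (by positivity) hR1
  · refine (h.abs_le_of_one_le hx h1).trans ?_
    rw [mul_assoc (pointwiseConst * M)]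
    gcongr
    calc ‖x‖ ^ (-7 / 8 : ℝ) ≤ 1 := Real.rpow_le_one_of_one_le_of_nonpos h1 (by norm_num)
      _ = √‖x‖ * ‖x‖ ^ (-1 / 2 : ℝ) := by
        rw [Real.sqrt_eq_rpow, ← Real.rpow_add hr]; norm_num
      _ ≤ _ := by gcongr

lemma sq_sub_le_abs (h : Controlled u g G M) {x y : R3} (hx : x ∈ G) (hy : y ∈ G) :
    sphereArea * (u x - u y) ^ 2 ≤ M ^ 2 * |1 / ‖x‖ - 1 / ‖y‖| := by
  rcases le_total ‖x‖ ‖y‖ with hxy | hxy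
  · exact (h.sq_sub_le hx hy hxy).trans (by gcongr; exact le_abs_self _)
  · rw [abs_sub_comm, ← neg_sub, neg_sq]
    exact (h.sq_sub_le hy hx hxy).trans (by gcongr; exact le_abs_self _)

end Controlled

/-- An Arzelà–Ascoli argument: the sequence is pointwise bounded and shares the modulus `M² |1/‖x‖ -
1/‖y‖|`. Compactness of a countable product gives convergence on a dense set, and equicontinuity
makes the values Cauchy at the other points. -/
lemma exists_subseq_tendsto {u : ℕ → R3 → ℝ} {g : ℕ → R3 → R3} {G : ℕ → Set R3} {M : ℝ}
    (h : ∀ n, Controlled (u n) (g n) (G n) M) :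
    ∃ k : ℕ → ℕ, StrictMono k ∧ ∃ v : R3 → ℝ, ∀ x ∈ ⋂ n, G n,
      Tendsto (fun n => u (k n) x) atTop (𝓝 (v x)) := by
  have hκ := sphereArea_pos
  -- The dense set is taken inside the intersection, because the oscillation bound only compares
  -- points of `G n`.
  obtain ⟨D, hDG, hDc, hGD⟩ := (TopologicalSpace.IsSeparable.of_separableSpace
    (⋂ n, G n)).exists_countable_dense_subset
  have : Countable D := hDc
  have hmem : ∀ {x}, x ∈ ⋂ n, G n → ∀ n, x ∈ G n := fun hx n => mem_iInter.1 hx n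
  set b : R3 → ℝ := fun x => pointwiseConst * M * √(max 1 ‖x‖) * ‖x‖ ^ (-1 / 2 : ℝ) with hb
  have hbd : ∀ n, (fun d : D => u n d) ∈ Set.pi univ fun d : D => Icc (-b d) (b d) := by
    intro n d _
    exact abs_le.1 ((h n).abs_le_of_norm_le (hmem (hDG d.2) n) (le_max_left _ _) (le_max_right _ _))
  obtain ⟨a, -, k, hk, hlim⟩ :=
    (isCompact_univ_pi fun d : D => isCompact_Icc (a := -b d) (b := b d)).tendsto_subseq hbd
  rw [tendsto_pi_nhds] at hlim
  have hcau : ∀ x ∈ ⋂ n, G n, ∃ l, Tendsto (fun n => u (k n) x) atTop (𝓝 l) := by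
    intro x hx
    apply cauchySeq_tendsto_of_complete
    rw [Metric.cauchySeq_iff]
    intro ε hε
    have hx0 : 0 < ‖x‖ := norm_pos_iff.2 fun e => (h 0).zero_notMem (e ▸ hmem hx 0)
    have hcont : Tendsto (fun y : R3 => M ^ 2 * |1 / ‖x‖ - 1 / ‖y‖|) (𝓝 x) (𝓝 0) := by
      have : ContinuousAt (fun y : R3 => M ^ 2 * |1 / ‖x‖ - 1 / ‖y‖|) x := by
        refine continuousAt_const.mul (ContinuousAt.abs (continuousAt_const.sub ?_))
        exact continuousAt_const.div continuous_norm.continuousAt hx0.ne'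
      simpa [ContinuousAt] using this
    have hev := hcont.eventually_lt_const (show 0 < sphereArea * (ε / 3) ^ 2 by positivity)
    obtain ⟨d, hd, hdD⟩ := mem_closure_iff_nhds.1 (hGD hx) _ hev
    have hd' : M ^ 2 * |1 / ‖x‖ - 1 / ‖d‖| < sphereArea * (ε / 3) ^ 2 := hd
    have hclose : ∀ n, |u n x - u n d| < ε / 3 := by
      intro n
      have h1 := ((h n).sq_sub_le_abs (hmem hx n) (hmem (hDG hdD) n)).trans_lt hd'
      exact abs_lt_of_sq_lt_sq (lt_of_mul_lt_mul_left h1 hκ.le) (by positivity)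
    obtain ⟨N, hN⟩ := Metric.cauchySeq_iff.1 (hlim ⟨d, hdD⟩).cauchySeq (ε / 3) (by positivity)
    refine ⟨N, fun m hm n hn => ?_⟩
    have h1 := hN m hm n hn
    have h2 := abs_lt.1 (hclose (k m))
    have h3 := abs_lt.1 (hclose (k n))
    simp only [Function.comp_apply, Real.dist_eq] at h1
    have h4 := abs_lt.1 h1
    rw [Real.dist_eq, abs_lt]
    constructor <;> linarith [h2.1, h2.2, h3.1, h3.2, h4.1, h4.2]
  choose! v hv using hcau
  exact ⟨k, hk, v, hv⟩

lemma lintegral_rpow_le_of_tendsto {f : ℕ → R3 → ℝ} {v : R3 → ℝ} {q : ℝ}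
    (hf : ∀ n, AEMeasurable (f n) volume)
    (hlim : ∀ᵐ x, Tendsto (fun n => f n x) atTop (𝓝 (v x))) {B : ℝ≥0∞}
    (hB : ∀ n, ∫⁻ x, ‖f n x‖ₑ ^ q ≤ B) : ∫⁻ x, ‖v x‖ₑ ^ q ≤ B := by
  calc ∫⁻ x, ‖v x‖ₑ ^ q = ∫⁻ x, liminf (fun n => ‖f n x‖ₑ ^ q) atTop := by
        refine lintegral_congr_ae ?_
        filter_upwards [hlim] with x hx
        exact ((ENNReal.continuous_rpow_const.tendsto _).comp hx.enorm).liminf_eq.symm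
    _ ≤ liminf (fun n => ∫⁻ x, ‖f n x‖ₑ ^ q) atTop :=
        lintegral_liminf_le' fun n => (hf n).enorm.pow_const q
    _ ≤ B := by
        refine liminf_le_of_le (by isBoundedDefault) fun b hb => ?_
        obtain ⟨n, hn⟩ := hb.exists
        exact hn.trans (hB n)

/-- Convergence in `L^p` of an almost everywhere convergent sequence with controlled energy. -/
lemma tendsto_lintegral_rpow_sub {u : ℕ → R3 → ℝ} {g : ℕ → R3 → R3} {G : ℕ → Set R3} {M : ℝ}
    (h : ∀ n, Controlled (u n) (g n) (G n) M) {v : R3 → ℝ}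
    (hv : ∀ᵐ x, Tendsto (fun n => u n x) atTop (𝓝 (v x))) {p : ℝ} (hp : 18 / 7 < p) (hp6 : p < 6) :
    Tendsto (fun n => ∫⁻ x, ‖u n x - v x‖ₑ ^ p) atTop (𝓝 0) := by
  have hK := pointwiseConst_pos
  have hκ := sphereArea_pos
  have hM := (h 0).nonneg
  have hvm : AEMeasurable v volume :=
    aemeasurable_of_tendsto_metrizable_ae _ (fun n => (h n).aemeasurable) hv
  have hG : ∀ᵐ x, ∀ n, x ∈ G n := ae_all_iff.2 fun n => (h n).ae_mem
  -- The room below `p` makes the tails uniformly small: far out, `p - q` powers of the difference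
  -- decay while its `L^q` integral stays bounded.
  obtain ⟨q, hq, hqp⟩ := exists_between hp
  obtain ⟨C, hC, hCu⟩ := exists_lintegral_rpow_le hq (hqp.trans hp6).le
  have hu_q : ∀ n, ∫⁻ x, ‖u n x‖ₑ ^ q ≤ ENNReal.ofReal (C * M ^ q) := fun n => hCu _ _ _ _ (h n)
  have hv_q : ∫⁻ x, ‖v x‖ₑ ^ q ≤ ENNReal.ofReal (C * M ^ q) :=
    lintegral_rpow_le_of_tendsto (fun n => (h n).aemeasurable) hv hu_q
  set T : ℝ≥0∞ := 2 ^ (q - 1) * (ENNReal.ofReal (C * M ^ q) + ENNReal.ofReal (C * M ^ q)) with hT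
  have hTt : T ≠ ⊤ := ENNReal.mul_ne_top (ENNReal.rpow_ne_top_of_nonneg (by linarith) (by simp))
    (by simp)
  have hdiff : ∀ n, ∫⁻ x, ‖u n x - v x‖ₑ ^ q ≤ T := by
    intro n
    calc _ ≤ ∫⁻ x, 2 ^ (q - 1) * (‖u n x‖ₑ ^ q + ‖v x‖ₑ ^ q) := by
          refine lintegral_mono fun x => ?_
          refine le_trans ?_ (ENNReal.rpow_add_le_mul_rpow_add_rpow _ _ (by linarith))
          gcongr
          exact enorm_sub_le
      _ = 2 ^ (q - 1) * ((∫⁻ x, ‖u n x‖ₑ ^ q) + ∫⁻ x, ‖v x‖ₑ ^ q) := by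
          rw [lintegral_const_mul' _ _ (ENNReal.rpow_ne_top_of_nonneg (by linarith) (by simp)),
            lintegral_add_right' _ (hvm.enorm.pow_const q)]
      _ ≤ T := by
          rw [hT]
          gcongr
          exact hu_q n
  -- the exterior region
  have hext : ∀ R : ℝ, 1 ≤ R → ∀ n, ∫⁻ x in {x : R3 | ‖x‖ ∈ Ioi R}, ‖u n x - v x‖ₑ ^ p ≤
      ENNReal.ofReal ((2 * (pointwiseConst * M * R ^ (-7 / 8 : ℝ))) ^ (p - q)) * T := by
    intro R hR n
    have hR0 : 0 < R := by linarith
    calc _ ≤ ∫⁻ x in {x : R3 | ‖x‖ ∈ Ioi R},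
          ENNReal.ofReal ((2 * (pointwiseConst * M * R ^ (-7 / 8 : ℝ))) ^ (p - q)) *
            ‖u n x - v x‖ₑ ^ q := by
          refine lintegral_mono_ae ?_
          filter_upwards [ae_restrict_mem (measurableSet_norm_mem measurableSet_Ioi),
            ae_restrict_of_ae hv, ae_restrict_of_ae hG] with x hx hxv hxG
          have hxR : R ≤ ‖x‖ := le_of_lt hx
          have h1 : ∀ m, |u m x| ≤ pointwiseConst * M * R ^ (-7 / 8 : ℝ) := by
            intro m
            refine ((h m).abs_le_of_one_le (hxG m) (hR.trans hxR)).trans ?_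
            exact mul_le_mul_of_nonneg_left
              (Real.rpow_le_rpow_of_nonpos hR0 hxR (by norm_num)) (by positivity)
          have h2 : |v x| ≤ pointwiseConst * M * R ^ (-7 / 8 : ℝ) :=
            le_of_tendsto hxv.abs (Eventually.of_forall h1)
          have h3 : ‖u n x - v x‖ₑ ≤
              ENNReal.ofReal (2 * (pointwiseConst * M * R ^ (-7 / 8 : ℝ))) := by
            rw [← ofReal_norm]
            refine ENNReal.ofReal_le_ofReal ((norm_sub_le _ _).trans ?_)
            rw [Real.norm_eq_abs, Real.norm_eq_abs]
            linarith [h1 n]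
          rw [← ENNReal.ofReal_rpow_of_nonneg (by positivity) (by linarith)]
          calc _ = ‖u n x - v x‖ₑ ^ (p - q) * ‖u n x - v x‖ₑ ^ q := by
                rw [← ENNReal.rpow_add_of_nonneg _ _ (by linarith) (by linarith)]
                ring_nf
            _ ≤ _ := by gcongr
      _ ≤ _ := by
          rw [lintegral_const_mul' _ _ ENNReal.ofReal_ne_top]
          gcongr
          exact (setLIntegral_le_lintegral _ _).trans (hdiff n)
  -- the interior region
  have hint : ∀ R : ℝ, 1 ≤ R → Tendsto (fun n =>
      ∫⁻ x in {x : R3 | ‖x‖ ∈ Ioc 0 R}, ‖u n x - v x‖ₑ ^ p) atTop (𝓝 0) := by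
    intro R hR
    set c : ℝ := (2 * (pointwiseConst * M * √R)) ^ p with hc
    have hlim0 : ∫⁻ x in {x : R3 | ‖x‖ ∈ Ioc 0 R}, (0 : ℝ≥0∞) = 0 := by simp
    rw [← hlim0]
    -- The majorant `‖x‖ ^ (-p/2)` is integrable at the origin because `p < 6`; this is where the
    -- endpoint is lost.
    refine tendsto_lintegral_of_dominated_convergence'
      (fun x => ENNReal.ofReal c * ENNReal.ofReal (‖x‖ ^ (-p / 2))) ?_ ?_ ?_ ?_
    · exact fun n => (((h n).aemeasurable.sub hvm).enorm.pow_const p).restrict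
    · intro n
      filter_upwards [ae_restrict_mem (measurableSet_norm_mem measurableSet_Ioc),
        ae_restrict_of_ae hv, ae_restrict_of_ae hG] with x hx hxv hxG
      have h1 := fun m => (h m).abs_le_of_norm_le (hxG m) hR hx.2
      have h2 : |v x| ≤ pointwiseConst * M * √R * ‖x‖ ^ (-1 / 2 : ℝ) :=
        le_of_tendsto hxv.abs (Eventually.of_forall h1)
      calc ‖u n x - v x‖ₑ ^ p
          ≤ ENNReal.ofReal (2 * (pointwiseConst * M * √R) * ‖x‖ ^ (-1 / 2 : ℝ)) ^ p := by
            gcongr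
            rw [← ofReal_norm]
            refine ENNReal.ofReal_le_ofReal ((norm_sub_le _ _).trans ?_)
            rw [Real.norm_eq_abs, Real.norm_eq_abs]
            linarith [h1 n]
        _ = _ := by
            rw [ENNReal.ofReal_rpow_of_nonneg (by positivity) (by linarith),
              ← ENNReal.ofReal_mul (by positivity), Real.mul_rpow (by positivity)
              (by positivity), ← Real.rpow_mul (norm_nonneg _), hc]
            ring_nf
    · rw [lintegral_const_mul' _ _ ENNReal.ofReal_ne_top,
        setLIntegral_norm_rpow_Ioc (by linarith) (by linarith)]
      exact ENNReal.mul_ne_top ENNReal.ofReal_ne_top ENNReal.ofReal_ne_top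
    · filter_upwards [ae_restrict_of_ae hv] with x hx
      have h1 : Tendsto (fun n => ‖u n x - v x‖ₑ) atTop (𝓝 0) := by
        have := (hx.sub_const (v x)).enorm
        simpa using this
      have h2 := (ENNReal.continuous_rpow_const (y := p)).tendsto 0 |>.comp h1
      rwa [ENNReal.zero_rpow_of_pos (by linarith)] at h2
  rw [ENNReal.tendsto_nhds_zero]
  intro ε hε
  have hdecay : Tendsto (fun R : ℝ =>
      ENNReal.ofReal ((2 * (pointwiseConst * M * R ^ (-7 / 8 : ℝ))) ^ (p - q)) * T)
      atTop (𝓝 0) := by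
    have h1 : Tendsto (fun R : ℝ => R ^ (-7 / 8 : ℝ)) atTop (𝓝 0) := by
      have := tendsto_rpow_neg_atTop (show (0 : ℝ) < 7 / 8 by norm_num)
      simpa [neg_div] using this
    have h2 : Tendsto (fun R : ℝ => (2 * (pointwiseConst * M * R ^ (-7 / 8 : ℝ))) ^ (p - q))
        atTop (𝓝 0) := by
      have h3 := ((h1.const_mul (pointwiseConst * M)).const_mul 2).rpow_const
        (p := p - q) (Or.inr (by linarith))
      simpa [Real.zero_rpow (show p - q ≠ 0 by linarith)] using h3
    have h4 := ENNReal.Tendsto.mul_const (ENNReal.tendsto_ofReal h2) (Or.inr hTt)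
    simpa using h4
  obtain ⟨R, hRε, hR⟩ := ((ENNReal.tendsto_nhds_zero.1 hdecay (ε / 2)
    (ENNReal.half_pos hε.ne')).and (eventually_ge_atTop 1)).exists
  filter_upwards [ENNReal.tendsto_nhds_zero.1 (hint R hR) (ε / 2) (ENNReal.half_pos hε.ne')]
    with n hn
  have hcover : ({0}ᶜ : Set R3) ⊆ {x : R3 | ‖x‖ ∈ Ioc 0 R} ∪ {x : R3 | ‖x‖ ∈ Ioi R} := by
    intro x hx
    rcases le_or_gt ‖x‖ R with h1 | h1
    · exact Or.inl ⟨norm_pos_iff.2 hx, h1⟩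
    · exact Or.inr h1
  calc _ = ∫⁻ x in ({0}ᶜ : Set R3), ‖u n x - v x‖ₑ ^ p := by rw [restrict_compl_singleton]
    _ ≤ _ := (lintegral_mono_set hcover).trans (lintegral_union_le _ _ _)
    _ ≤ ε / 2 + ε / 2 := add_le_add hn ((hext R hR n).trans hRε)
    _ = ε := ENNReal.add_halves ε

theorem compact_inclusion (p : ℝ≥0∞) (hp : 18 / 7 < p) (hp6 : p < 6) (u : ℕ → R3 → ℝ)
    (hu : ∀ n, MemEr (u n)) (hM : ∃ M : ℝ≥0, ∀ n, normE (u n) ≤ M) :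
    ∃ k : ℕ → ℕ, StrictMono k ∧ ∃ v : R3 → ℝ, MemLp v p volume ∧
      Tendsto (fun n => eLpNorm (u (k n) - v) p volume) atTop (𝓝 0) := by
  obtain ⟨M, hM⟩ := hM
  obtain ⟨hp0, hpt, hpr, hpr6⟩ := exponent_bounds hp hp6.le
  have hpr6' : p.toReal < 6 := by
    have := (ENNReal.toReal_lt_toReal hpt (by simp)).2 hp6
    simpa using this
  have hpos : 0 < p.toReal := by linarith
  choose G hG using fun n => exists_controlled (hu n) M.2 (by simpa using hM n)
  obtain ⟨k, hk, v, hv⟩ := exists_subseq_tendsto hG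
  have hvae : ∀ᵐ x, Tendsto (fun n => u (k n) x) atTop (𝓝 (v x)) := by
    filter_upwards [ae_all_iff.2 fun n => (hG n).ae_mem] with x hx
    exact hv x (mem_iInter.2 hx)
  have hvm : AEMeasurable v volume :=
    aemeasurable_of_tendsto_metrizable_ae _ (fun n => (hG (k n)).aemeasurable) hvae
  obtain ⟨C, hC, hCu⟩ := exists_lintegral_rpow_le hpr hpr6
  have hv_p : ∫⁻ x, ‖v x‖ₑ ^ p.toReal ≤ ENNReal.ofReal (C * M ^ p.toReal) :=
    lintegral_rpow_le_of_tendsto (fun n => (hG (k n)).aemeasurable) hvae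
      fun n => hCu _ _ _ _ (hG (k n))
  refine ⟨k, hk, v, ⟨hvm.aestronglyMeasurable, ?_⟩, ?_⟩
  · exact (eLpNorm_le_of_lintegral_le hp0 hpt hC M.2 hv_p).trans_lt
      (ENNReal.mul_lt_top ENNReal.ofReal_lt_top ENNReal.ofReal_lt_top)
  · have h1 := tendsto_lintegral_rpow_sub (fun n => hG (k n)) hvae hpr hpr6'
    have h2 := (ENNReal.continuous_rpow_const (y := 1 / p.toReal)).tendsto 0 |>.comp h1
    rw [ENNReal.zero_rpow_of_pos (by positivity)] at h2
    refine h2.congr fun n => ?_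
    rw [eLpNorm_eq_lintegral_rpow_enorm_toReal hp0 hpt]
    rfl

/-! ### The Coulomb potential of a shell -/

lemma measurePreserving_coords (i : Fin 3) :
    MeasurePreserving (fun y : R3 => (y i, (y (i.succAbove 0), y (i.succAbove 1))))
      volume (volume : Measure (ℝ × (ℝ × ℝ))) :=
  ((MeasurePreserving.id volume).prod (volume_preserving_finTwoArrow ℝ)).comp
    ((volume_preserving_piFinSuccAbove (fun _ => ℝ) i).comp (PiLp.volume_preserving_ofLp (Fin 3)))

lemma norm_sq_coords (y : R3) (i : Fin 3) :
    ‖y‖ ^ 2 = y i ^ 2 + (y (i.succAbove 0) ^ 2 + y (i.succAbove 1) ^ 2) := by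
  rw [EuclideanSpace.norm_sq_eq, Fin.sum_univ_succAbove _ i, Fin.sum_univ_two]
  simp

/-- The kernel `|t|^{-1/2}`, infinite at `0`. -/
noncomputable def halfKernel (t : ℝ) : ℝ≥0∞ := ENNReal.ofReal |t| ^ (-1 / 2 : ℝ)

lemma measurable_halfKernel : Measurable halfKernel := by
  unfold halfKernel
  fun_prop

lemma halfKernel_ne_zero (t : ℝ) : halfKernel t ≠ 0 := by
  unfold halfKernel
  rw [Ne, ENNReal.rpow_eq_zero_iff]
  rintro (h | h)
  · linarith [h.2]
  · exact ENNReal.ofReal_ne_top h.1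

lemma halfKernel_zero : halfKernel 0 = ⊤ := by
  unfold halfKernel
  simp only [abs_zero, ENNReal.ofReal_zero]
  exact ENNReal.zero_rpow_of_neg (by norm_num)

lemma halfKernel_of_ne {t : ℝ} (ht : t ≠ 0) :
    halfKernel t = ENNReal.ofReal (|t| ^ (-1 / 2 : ℝ)) :=
  ENNReal.ofReal_rpow_of_pos (abs_pos.2 ht)

/-- Since `‖z‖² ≥ a² + b² ≥ ab` for two coordinates of moduli `a`, `b`, the Coulomb kernel is
dominated by a product of one-variable kernels. The value `⊤` of `halfKernel` at `0` covers the
coordinate planes. -/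
lemma ofReal_one_div_norm_le (z : R3) (i : Fin 3) :
    ENNReal.ofReal (1 / ‖z‖) ≤ halfKernel (z (i.succAbove 0)) * halfKernel (z (i.succAbove 1)) := by
  by_cases h0 : z (i.succAbove 0) = 0
  · rw [h0, halfKernel_zero, ENNReal.top_mul (halfKernel_ne_zero _)]
    exact le_top
  by_cases h1 : z (i.succAbove 1) = 0
  · rw [h1, halfKernel_zero, ENNReal.mul_top (halfKernel_ne_zero _)]
    exact le_top
  rw [halfKernel_of_ne h0, halfKernel_of_ne h1, ← ENNReal.ofReal_mul (by positivity)]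
  refine ENNReal.ofReal_le_ofReal ?_
  set a := |z (i.succAbove 0)| with ha
  set b := |z (i.succAbove 1)| with hb
  have hap : 0 < a := abs_pos.2 h0
  have hbp : 0 < b := abs_pos.2 h1
  have hn : ‖z‖ ^ 2 = z i ^ 2 + (a ^ 2 + b ^ 2) := by
    rw [ha, hb, sq_abs, sq_abs]; exact norm_sq_coords z i
  have hab : √(a * b) ≤ ‖z‖ := by
    apply Real.sqrt_le_iff.2 ⟨norm_nonneg _, ?_⟩
    nlinarith [sq_nonneg (z i), sq_nonneg (a - b)]
  rw [← Real.mul_rpow hap.le hbp.le, neg_div, Real.rpow_neg (by positivity),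
    ← Real.sqrt_eq_rpow, one_div]
  have : 0 < √(a * b) := by positivity
  gcongr

lemma lintegral_halfKernel_near {r : ℝ} (hr : 0 ≤ r) :
    ∫⁻ t in Icc (-r) r, halfKernel t ≤ ENNReal.ofReal (4 * √r) := by
  have hpos : ∫⁻ t in Ioc 0 r, halfKernel t = ENNReal.ofReal (2 * √r) := by
    have h1 : ∫⁻ t in Ioc 0 r, halfKernel t =
        ∫⁻ t in Ioc 0 r, ENNReal.ofReal (t ^ (-1 / 2 : ℝ)) := by
      refine setLIntegral_congr_fun measurableSet_Ioc fun t ht => ?_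
      rw [halfKernel_of_ne ht.1.ne', abs_of_pos ht.1]
    rw [h1, ← ofReal_integral_eq_lintegral_ofReal, ← intervalIntegral.integral_of_le hr,
      integral_rpow (Or.inl (by norm_num))]
    · congr 1
      rw [Real.zero_rpow (by norm_num), Real.sqrt_eq_rpow]
      norm_num
      ring
    · exact (intervalIntegral.intervalIntegrable_rpow' (by norm_num)).1
    · filter_upwards [ae_restrict_mem measurableSet_Ioc] with t ht
      exact Real.rpow_nonneg ht.1.le _
  have hneg : ∫⁻ t in Ico (-r) 0, halfKernel t = ENNReal.ofReal (2 * √r) := by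
    rw [← hpos, ← lintegral_indicator measurableSet_Ico, ← lintegral_indicator measurableSet_Ioc,
      ← lintegral_neg_eq_self]
    refine lintegral_congr fun t => ?_
    have : -t ∈ Ico (-r) 0 ↔ t ∈ Ioc 0 r := by
      simp only [mem_Ico, mem_Ioc]
      constructor <;> rintro ⟨h1, h2⟩ <;> constructor <;> linarith
    by_cases ht : t ∈ Ioc 0 r
    · rw [indicator_of_mem ht, indicator_of_mem (this.2 ht), halfKernel, halfKernel, abs_neg]
    · rw [indicator_of_notMem ht, indicator_of_notMem (mt this.1 ht)]
  have hsub : Icc (-r) r ⊆ (Ico (-r) 0 ∪ Ioc 0 r) ∪ {0} := by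
    intro t ht
    rcases lt_trichotomy t 0 with h | h | h
    · exact Or.inl (Or.inl ⟨ht.1, h⟩)
    · exact Or.inr h
    · exact Or.inl (Or.inr ⟨h, ht.2⟩)
  calc _ ≤ (∫⁻ t in Ico (-r) 0, halfKernel t) + (∫⁻ t in Ioc 0 r, halfKernel t) +
        ∫⁻ t in ({0} : Set ℝ), halfKernel t :=
        (lintegral_mono_set hsub).trans ((lintegral_union_le _ _ _).trans
          (by gcongr; exact lintegral_union_le _ _ _))
    _ = _ := by
        rw [hpos, hneg, setLIntegral_measure_zero _ _ (by simp), add_zero,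
          ← ENNReal.ofReal_add (by positivity) (by positivity)]
        ring_nf

/-- Split at distance `R` from `a`: translation bounds the near part independently of `a`, and
farther out the kernel is at most `R ^ (-1/2)` on an interval of length `4R`. -/
lemma lintegral_halfKernel_sub_le {R : ℝ} (hR : 0 < R) (a : ℝ) :
    ∫⁻ t in Icc (-(2 * R)) (2 * R), halfKernel (a - t) ≤ ENNReal.ofReal (8 * √R) := by
  calc _ ≤ ∫⁻ t, ((Icc (-R) R).indicator halfKernel (a - t) +
        (Icc (-(2 * R)) (2 * R)).indicator (fun _ => ENNReal.ofReal (R ^ (-1 / 2 : ℝ))) t) := by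
        rw [← lintegral_indicator measurableSet_Icc]
        refine lintegral_mono fun t => ?_
        by_cases ht : t ∈ Icc (-(2 * R)) (2 * R)
        · rw [indicator_of_mem ht, indicator_of_mem ht]
          by_cases h1 : a - t ∈ Icc (-R) R
          · rw [indicator_of_mem h1]
            exact le_self_add
          · refine le_trans ?_ le_add_self
            have h2 : R < |a - t| := by
              rw [mem_Icc, ← abs_le, not_le] at h1; exact h1
            rw [halfKernel_of_ne (abs_pos.1 (hR.trans h2))]
            exact ENNReal.ofReal_le_ofReal
              (Real.rpow_le_rpow_of_nonpos hR h2.le (by norm_num))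
        · rw [indicator_of_notMem ht]
          exact zero_le
    _ = (∫⁻ t in Icc (-R) R, halfKernel t) +
        ENNReal.ofReal (R ^ (-1 / 2 : ℝ)) * ENNReal.ofReal (4 * R) := by
        rw [lintegral_add_right _ (measurable_const.indicator measurableSet_Icc),
          lintegral_sub_left_eq_self (fun t => (Icc (-R) R).indicator halfKernel t) a,
          lintegral_indicator measurableSet_Icc, lintegral_indicator measurableSet_Icc,
          setLIntegral_const, Real.volume_Icc]
        ring_nf
    _ ≤ ENNReal.ofReal (4 * √R) + ENNReal.ofReal (4 * √R) := by
        refine add_le_add (lintegral_halfKernel_near hR.le) (le_of_eq ?_)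
        rw [← ENNReal.ofReal_mul (by positivity)]
        congr 1
        rw [Real.sqrt_eq_rpow, mul_left_comm, ← Real.rpow_add_one hR.ne']
        norm_num
    _ = _ := by
        rw [← ENNReal.ofReal_add (by positivity) (by positivity)]
        ring_nf

/-- The fibres of a shell, away from the equator. -/
lemma volume_fibre_le {R l : ℝ} (hl : 0 < l) (hlR : l ≤ R) (s : ℝ) :
    volume {t : ℝ | R / 2 < |t| ∧ t ^ 2 + s ∈ Ioc (R ^ 2) ((R + l) ^ 2)} ≤
      ENNReal.ofReal (6 * l) := by
  have hR : 0 < R := hl.trans_le hlR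
  set P : Set ℝ := {t : ℝ | R / 2 < t ∧ t ^ 2 + s ∈ Ioc (R ^ 2) ((R + l) ^ 2)} with hP
  set Q : Set ℝ := {t : ℝ | t < -(R / 2) ∧ t ^ 2 + s ∈ Ioc (R ^ 2) ((R + l) ^ 2)} with hQ
  -- Here `a² - b² ≤ (R + l)² - R² ≤ 3lR`, while `a + b > R`.
  have hdist : ∀ a b : ℝ, R / 2 < a → R / 2 < b → a ^ 2 + s ≤ (R + l) ^ 2 →
      R ^ 2 < b ^ 2 + s → a - b ≤ 3 * l := by
    intro a b ha hb h1 h2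
    by_contra! hcon
    nlinarith [mul_lt_mul'' hcon (show R < a + b by linarith) (by positivity) hR.le]
  have hPv : volume P ≤ ENNReal.ofReal (3 * l) := by
    refine (Real.volume_le_diam P).trans (Metric.ediam_le fun a ha b hb => ?_)
    rw [edist_dist, Real.dist_eq]
    refine ENNReal.ofReal_le_ofReal (abs_le.2 ⟨?_, ?_⟩)
    · linarith [hdist b a hb.1 ha.1 hb.2.2 ha.2.1]
    · exact hdist a b ha.1 hb.1 ha.2.2 hb.2.1
  have hQv : volume Q ≤ ENNReal.ofReal (3 * l) := by
    refine (Real.volume_le_diam Q).trans (Metric.ediam_le fun a ha b hb => ?_)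
    rw [edist_dist, Real.dist_eq]
    have ha1 : R / 2 < -a := by linarith [ha.1]
    have hb1 : R / 2 < -b := by linarith [hb.1]
    refine ENNReal.ofReal_le_ofReal (abs_le.2 ⟨?_, ?_⟩)
    · linarith [hdist (-a) (-b) ha1 hb1 (by rw [neg_sq]; exact ha.2.2)
        (by rw [neg_sq]; exact hb.2.1)]
    · linarith [hdist (-b) (-a) hb1 ha1 (by rw [neg_sq]; exact hb.2.2)
        (by rw [neg_sq]; exact ha.2.1)]
  calc _ ≤ volume (P ∪ Q) := by
        refine measure_mono fun t ht => ?_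
        rcases lt_abs.1 ht.1 with h | h
        · exact Or.inl ⟨h, ht.2⟩
        · exact Or.inr ⟨by linarith, ht.2⟩
    _ ≤ ENNReal.ofReal (3 * l) + ENNReal.ofReal (3 * l) :=
        (measure_union_le _ _).trans (add_le_add hPv hQv)
    _ = _ := by
        rw [← ENNReal.ofReal_add (by positivity) (by positivity)]
        ring_nf

/-- The product bound on the kernel omits coordinate `i`, and lines in that direction meet the
sector in length at most `6l`. Tonelli leaves two integrals of size `8√R`; `384 = 6 · 8 · 8`. -/
lemma lintegral_sector_le {R l : ℝ} (hl : 0 < l) (hlR : l ≤ R) (x : R3) (i : Fin 3) :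
    ∫⁻ y in {y : R3 | ‖y‖ ∈ Ioc R (R + l) ∧ R / 2 < |y i|}, ENNReal.ofReal (1 / ‖x - y‖) ≤
      ENNReal.ofReal (384 * (l * R)) := by
  have hR : 0 < R := hl.trans_le hlR
  set a := x (i.succAbove 0) with ha
  set b := x (i.succAbove 1) with hb
  set I : Set ℝ := Icc (-(2 * R)) (2 * R) with hI
  set F : Set (ℝ × (ℝ × ℝ)) :=
    {q | R / 2 < |q.1| ∧ q.1 ^ 2 + (q.2.1 ^ 2 + q.2.2 ^ 2) ∈ Ioc (R ^ 2) ((R + l) ^ 2)} with hF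
  have hFm : MeasurableSet F := by
    have h1 : MeasurableSet {q : ℝ × (ℝ × ℝ) | R / 2 < |q.1|} :=
      measurableSet_lt (by fun_prop) (by fun_prop)
    have h2 : Measurable fun q : ℝ × (ℝ × ℝ) => q.1 ^ 2 + (q.2.1 ^ 2 + q.2.2 ^ 2) := by fun_prop
    exact h1.inter (h2 measurableSet_Ioc)
  set f : ℝ → ℝ≥0∞ := I.indicator fun t => halfKernel (a - t) with hf
  set k : ℝ → ℝ≥0∞ := I.indicator fun t => halfKernel (b - t) with hk
  have hfm : Measurable f :=
    (measurable_halfKernel.comp (measurable_const.sub measurable_id)).indicator measurableSet_Icc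
  have hkm : Measurable k :=
    (measurable_halfKernel.comp (measurable_const.sub measurable_id)).indicator measurableSet_Icc
  set H : ℝ × (ℝ × ℝ) → ℝ≥0∞ := fun q => F.indicator 1 q * (f q.2.1 * k q.2.2) with hH
  have hHm : Measurable H :=
    (measurable_one.indicator hFm).mul ((hfm.comp (by fun_prop)).mul (hkm.comp (by fun_prop)))
  have hSm : MeasurableSet {y : R3 | ‖y‖ ∈ Ioc R (R + l) ∧ R / 2 < |y i|} := by
    have h1 : MeasurableSet {y : R3 | R / 2 < |y i|} :=
      measurableSet_lt (by fun_prop) (by fun_prop)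
    exact (measurableSet_norm_mem measurableSet_Ioc).inter h1
  calc _ ≤ ∫⁻ y : R3, H (y i, (y (i.succAbove 0), y (i.succAbove 1))) := by
        rw [← lintegral_indicator hSm]
        refine lintegral_mono fun y => ?_
        by_cases hy : y ∈ {y : R3 | ‖y‖ ∈ Ioc R (R + l) ∧ R / 2 < |y i|}
        · rw [indicator_of_mem hy]
          have hn := norm_sq_coords y i
          have hy1 : R < ‖y‖ := hy.1.1
          have hy2 : ‖y‖ ≤ R + l := hy.1.2
          have hFy : (y i, (y (i.succAbove 0), y (i.succAbove 1))) ∈ F := by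
            refine ⟨hy.2, ?_⟩
            simp only [← hn]
            exact ⟨by gcongr, by gcongr⟩
          have hIy : ∀ j, y j ∈ I := fun j => by
            have h1 : |y j| ≤ ‖y‖ := PiLp.norm_apply_le y j
            exact abs_le.1 (h1.trans (hy2.trans (by linarith)))
          simp only [hH, hf, hk]
          rw [indicator_of_mem hFy, indicator_of_mem (hIy _), indicator_of_mem (hIy _),
            Pi.one_apply, one_mul]
          exact ofReal_one_div_norm_le (x - y) i
        · rw [indicator_of_notMem hy]
          exact zero_le
    _ = ∫⁻ q, H q := (measurePreserving_coords i).lintegral_comp hHm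
    _ = ∫⁻ s : ℝ × ℝ, ∫⁻ t, H (t, s) := lintegral_prod_symm' _ hHm
    _ ≤ ∫⁻ s : ℝ × ℝ, ENNReal.ofReal (6 * l) * (f s.1 * k s.2) := by
        refine lintegral_mono fun s => ?_
        simp only [hH]
        have hm : MeasurableSet {t : ℝ | (t, s) ∈ F} := hFm.preimage (by fun_prop)
        have h1 : ∫⁻ t : ℝ, F.indicator (1 : ℝ × (ℝ × ℝ) → ℝ≥0∞) (t, s) =
            volume {t : ℝ | (t, s) ∈ F} := by
          rw [← lintegral_indicator_one hm]
          rfl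
        have h2 : Measurable fun t : ℝ => F.indicator (1 : ℝ × (ℝ × ℝ) → ℝ≥0∞) (t, s) :=
          (measurable_one.indicator hFm).comp (by fun_prop)
        rw [lintegral_mul_const _ h2, h1]
        gcongr
        exact volume_fibre_le hl hlR (s.1 ^ 2 + s.2 ^ 2)
    _ = ENNReal.ofReal (6 * l) * ((∫⁻ t in I, halfKernel (a - t)) *
          ∫⁻ t in I, halfKernel (b - t)) := by
        rw [lintegral_const_mul' _ _ ENNReal.ofReal_ne_top, Measure.volume_eq_prod,
          lintegral_prod_mul hfm.aemeasurable hkm.aemeasurable,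
          hf, hk, lintegral_indicator measurableSet_Icc, lintegral_indicator measurableSet_Icc]
    _ ≤ ENNReal.ofReal (6 * l) * (ENNReal.ofReal (8 * √R) * ENNReal.ofReal (8 * √R)) := by
        gcongr
        · exact lintegral_halfKernel_sub_le hR a
        · exact lintegral_halfKernel_sub_le hR b
    _ = _ := by
        rw [← ENNReal.ofReal_mul (by positivity), ← ENNReal.ofReal_mul (by positivity)]
        congr 1
        have := Real.mul_self_sqrt hR.le
        linear_combination (384 * l) * this

/-- The potential of the uniform shell of radius `R` and thickness `l` is bounded by `C l R`. -/
lemma lintegral_shell_le {R l : ℝ} (hl : 0 < l) (hlR : l ≤ R) (x : R3) :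
    ∫⁻ y in {y : R3 | ‖y‖ ∈ Ioc R (R + l)}, ENNReal.ofReal (1 / ‖x - y‖) ≤
      ENNReal.ofReal (1152 * (l * R)) := by
  have hR : 0 < R := hl.trans_le hlR
  -- If every coordinate were at most `R / 2` in modulus, then `‖y‖² ≤ 3R²/4`.
  have hsub : {y : R3 | ‖y‖ ∈ Ioc R (R + l)} ⊆
      ⋃ i : Fin 3, {y : R3 | ‖y‖ ∈ Ioc R (R + l) ∧ R / 2 < |y i|} := by
    intro y hy
    by_contra hcon
    simp only [mem_iUnion, not_exists] at hcon
    have h1 : ∀ i, y i ^ 2 ≤ (R / 2) ^ 2 := by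
      intro i
      have h2 : |y i| ≤ R / 2 := by
        by_contra! h3
        exact hcon i ⟨hy, h3⟩
      exact sq_le_sq' (by linarith [(abs_le.1 h2).1]) (abs_le.1 h2).2
    have h3 := norm_sq_coords y 0
    have h4 : R ^ 2 < ‖y‖ ^ 2 := by
      have := hy.1
      gcongr
    nlinarith [h1 0, h1 (Fin.succAbove 0 0), h1 (Fin.succAbove 0 1)]
  calc _ ≤ ∑' i : Fin 3, ∫⁻ y in {y : R3 | ‖y‖ ∈ Ioc R (R + l) ∧ R / 2 < |y i|},
        ENNReal.ofReal (1 / ‖x - y‖) :=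
        (lintegral_mono_set hsub).trans (lintegral_iUnion_le _ _)
    _ ≤ ∑' _ : Fin 3, ENNReal.ofReal (384 * (l * R)) :=
        ENNReal.tsum_le_tsum fun i => lintegral_sector_le hl hlR x i
    _ = _ := by
        rw [tsum_fintype, Finset.sum_const, Finset.card_univ, Fintype.card_fin,
          ← ENNReal.ofReal_nsmul]
        norm_num
        ring_nf

/-! ### Sums of bumps on disjoint shells -/

/-- A smooth bump on the line, supported in `(0, 1)` and equal to `1` on `[1/4, 3/4]`. -/
noncomputable def bump : ContDiffBump (1 / 2 : ℝ) := ⟨1 / 4, 1 / 2, by norm_num, by norm_num⟩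

lemma bump_eq_zero {t : ℝ} (ht : t ∉ Ioo (0 : ℝ) 1) : bump t = 0 := by
  have h : t ∉ Function.support bump := by
    rw [bump.support_eq]
    change t ∉ ball (1 / 2 : ℝ) (1 / 2)
    rw [Real.ball_eq_Ioo]
    norm_num at ht ⊢
    exact ht
  simpa using h

lemma bump_eq_one {t : ℝ} (ht : t ∈ Icc (1 / 4 : ℝ) (3 / 4)) : bump t = 1 := by
  refine bump.one_of_mem_closedBall ?_
  change t ∈ closedBall (1 / 2 : ℝ) (1 / 4)
  rw [Real.closedBall_eq_Icc]
  norm_num at ht ⊢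
  exact ht

/-- At such points, endpoints included, the nonnegative bump attains its minimum. -/
lemma deriv_bump_eq_zero {t : ℝ} (ht : t ∉ Ioo (0 : ℝ) 1) : deriv bump t = 0 := by
  refine IsLocalMin.deriv_eq_zero (Eventually.of_forall fun s => ?_)
  rw [bump_eq_zero ht]
  exact bump.nonneg

lemma exists_abs_deriv_bump_le : ∃ L : ℝ, 0 ≤ L ∧ ∀ t, |deriv bump t| ≤ L := by
  have hc : Continuous (deriv bump) := (bump.contDiff (n := 1)).continuous_deriv le_rfl
  have hs : HasCompactSupport (deriv bump) := bump.hasCompactSupport.deriv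
  obtain ⟨L, hL⟩ := hc.bounded_above_of_compact_support hs
  exact ⟨L, (norm_nonneg _).trans (hL 0), hL⟩

/-- A sequence of disjoint shells of radius `R k` and thickness `l k`, with heights `h k`. -/
structure Shells where
  R : ℕ → ℝ
  l : ℕ → ℝ
  h : ℕ → ℝ
  l_pos : ∀ k, 0 < l k
  l_le : ∀ k, l k ≤ R k
  h_pos : ∀ k, 0 < h k
  disjoint : ∀ j k, j ≠ k → Disjoint (Ioc (R j) (R j + l j)) (Ioc (R k) (R k + l k))

namespace Shells

variable (s : Shells)

lemma R_pos (k : ℕ) : 0 < s.R k := (s.l_pos k).trans_le (s.l_le k)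

/-- The `k`-th shell. -/
def shell (k : ℕ) : Set R3 := {x : R3 | ‖x‖ ∈ Ioc (s.R k) (s.R k + s.l k)}

lemma measurableSet_shell (k : ℕ) : MeasurableSet (s.shell k) :=
  measurableSet_norm_mem measurableSet_Ioc

lemma volume_shell_le (k : ℕ) :
    volume (s.shell k) ≤ ENNReal.ofReal (3 * sphereArea * (s.R k ^ 2 * s.l k)) := by
  have hl := s.l_pos k
  have hR := s.R_pos k
  have hκ := sphereArea_pos
  rw [shell, volume_norm_mem_Ioc hR.le (by linarith)]
  refine ENNReal.ofReal_le_ofReal ?_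
  have h1 : ((s.R k + s.l k) ^ 3 - s.R k ^ 3) / 3 ≤ 3 * (s.R k ^ 2 * s.l k) := by
    have h2 : s.l k ^ 2 ≤ s.R k * s.l k := by nlinarith [s.l_le k]
    have h3 : s.l k ^ 3 ≤ s.R k ^ 2 * s.l k := by nlinarith [s.l_le k, mul_pos hl hR]
    nlinarith
  nlinarith

/-- The bump on the `k`-th shell. -/
noncomputable def term (k : ℕ) (x : R3) : ℝ := s.h k * bump ((‖x‖ - s.R k) / s.l k)

/-- The gradient of the bump on the `k`-th shell. -/
noncomputable def termGrad (k : ℕ) (x : R3) : R3 :=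
  (s.h k / s.l k * deriv bump ((‖x‖ - s.R k) / s.l k) / ‖x‖) • x

/-- The sum of the bumps. -/
noncomputable def sum (x : R3) : ℝ := ∑' k, s.term k x

/-- The sum of the gradients of the bumps. -/
noncomputable def sumGrad (x : R3) : R3 := ∑' k, s.termGrad k x

variable {s}

lemma scaled_notMem {k : ℕ} {r : ℝ} (hr : r ∉ Ioc (s.R k) (s.R k + s.l k)) :
    (r - s.R k) / s.l k ∉ Ioo (0 : ℝ) 1 := by
  have hl := s.l_pos k
  rintro ⟨h1, h2⟩
  rw [div_lt_one hl] at h2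
  have h3 : 0 < r - s.R k := by
    by_contra! h
    exact absurd h1 (not_lt.2 (div_nonpos_of_nonpos_of_nonneg h hl.le))
  exact hr ⟨by linarith, by linarith⟩

lemma term_eq_zero {k : ℕ} {x : R3} (hx : x ∉ s.shell k) : s.term k x = 0 := by
  rw [term, bump_eq_zero (scaled_notMem hx), mul_zero]

lemma termGrad_eq_zero {k : ℕ} {x : R3} (hx : x ∉ s.shell k) : s.termGrad k x = 0 := by
  rw [termGrad, deriv_bump_eq_zero (scaled_notMem hx)]
  simp

lemma term_nonneg (k : ℕ) (x : R3) : 0 ≤ s.term k x :=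
  mul_nonneg (s.h_pos k).le bump.nonneg

lemma term_le (k : ℕ) (x : R3) : s.term k x ≤ s.h k :=
  mul_le_of_le_one_right (s.h_pos k).le bump.le_one

lemma contDiff_profile (k : ℕ) :
    ContDiff ℝ ∞ fun r : ℝ => s.h k * bump ((r - s.R k) / s.l k) :=
  contDiff_const.mul (bump.contDiff.comp ((contDiff_id.sub contDiff_const).div_const _))

lemma profile_eq_zero {k : ℕ} {r : ℝ} (hr : r ∉ Ioc (s.R k) (s.R k + s.l k)) :
    s.h k * bump ((r - s.R k) / s.l k) = 0 := by
  rw [bump_eq_zero (scaled_notMem hr), mul_zero]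

lemma contDiff_term (k : ℕ) : ContDiff ℝ ∞ (s.term k) :=
  contDiff_comp_norm (q := fun r => s.h k * bump ((r - s.R k) / s.l k)) (s.R_pos k)
    (fun _ ht => profile_eq_zero fun h => absurd h.1 (not_lt.2 ht))
    fun _ _ => (contDiff_profile k).contDiffAt

lemma hasCompactSupport_term (k : ℕ) : HasCompactSupport (s.term k) :=
  hasCompactSupport_comp_norm (q := fun r => s.h k * bump ((r - s.R k) / s.l k))
    (b := s.R k + s.l k + 1)
    fun _ ht => profile_eq_zero fun h => by linarith [h.2]

lemma fderiv_term (k : ℕ) (x : R3) (i : Fin 3) :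
    fderiv ℝ (s.term k) x (EuclideanSpace.single i 1) = s.termGrad k x i := by
  by_cases hx : x = 0
  · subst hx
    have hev : s.term k =ᶠ[𝓝 0] fun _ => 0 := by
      filter_upwards [ball_mem_nhds (0 : R3) (s.R_pos k)] with y hy
      exact term_eq_zero fun h => absurd h.1 (not_lt.2 (mem_ball_zero_iff.1 hy).le)
    rw [hev.fderiv_eq]
    simp [termGrad]
  · have hd : HasDerivAt (fun r : ℝ => s.h k * bump ((r - s.R k) / s.l k))
        (s.h k * (deriv bump ((‖x‖ - s.R k) / s.l k) * (1 / s.l k))) ‖x‖ := by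
      refine HasDerivAt.const_mul _ ?_
      have hb : HasDerivAt bump (deriv bump ((‖x‖ - s.R k) / s.l k)) ((‖x‖ - s.R k) / s.l k) :=
        ((bump.contDiff (n := 1)).differentiable (by simp) _).hasDerivAt
      exact HasDerivAt.comp (h₂ := (bump : ℝ → ℝ)) (h := fun r => (r - s.R k) / s.l k) ‖x‖ hb
        (((hasDerivAt_id ‖x‖).sub_const _).div_const _)
    have h2 := hasFDerivAt_comp_norm hx hd
    have h3 : fderiv ℝ (s.term k) x = _ := h2.fderiv
    rw [h3, termGrad]
    simp [EuclideanSpace.inner_single_right]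
    left
    ring

lemma continuous_termGrad_apply (k : ℕ) (i : Fin 3) : Continuous fun x => s.termGrad k x i := by
  have h : (fun x => s.termGrad k x i) =
      fun x => fderiv ℝ (s.term k) x (EuclideanSpace.single i 1) :=
    funext fun x => (fderiv_term k x i).symm
  rw [h]
  exact ((contDiff_term k).continuous_fderiv (by simp)).clm_apply continuous_const

lemma measurable_termGrad (k : ℕ) : Measurable (s.termGrad k) := by
  unfold termGrad
  have h : Measurable (deriv bump) := measurable_deriv _
  refine Measurable.smul (Measurable.div ?_ measurable_norm) measurable_id
  exact measurable_const.mul (h.comp (by fun_prop))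

lemma norm_termGrad_le {L : ℝ} (hL : ∀ t, |deriv bump t| ≤ L) (k : ℕ) (x : R3) :
    ‖s.termGrad k x‖ ≤ s.h k / s.l k * L := by
  have hh := s.h_pos k
  have hl := s.l_pos k
  have hL0 : 0 ≤ L := (abs_nonneg _).trans (hL 0)
  rw [termGrad, norm_smul, norm_div, norm_norm, norm_mul, Real.norm_eq_abs, Real.norm_eq_abs,
    abs_of_pos (by positivity : 0 < s.h k / s.l k)]
  by_cases hx : ‖x‖ = 0
  · rw [hx, mul_zero]
    positivity
  · rw [div_mul_cancel₀ _ hx]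
    exact mul_le_mul_of_nonneg_left (hL _) (by positivity)

lemma isWeakGradient_term_integral (k : ℕ) {φ : R3 → ℝ} (hφ : ContDiff ℝ ∞ φ)
    (hφc : HasCompactSupport φ) (i : Fin 3) :
    ∫ x, s.term k x * fderiv ℝ φ x (EuclideanSpace.single i 1) =
      - ∫ x, s.termGrad k x i * φ x := by
  have hc := (contDiff_term (s := s) k).continuous
  have hφ' : Continuous fun x => fderiv ℝ φ x (EuclideanSpace.single i 1) :=
    (hφ.continuous_fderiv (by simp)).clm_apply continuous_const
  have h := integral_mul_fderiv_eq_neg_fderiv_mul_of_integrable (μ := volume) (f := s.term k)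
    (g := φ) (v := EuclideanSpace.single i 1) ?_ ?_ ?_
    (fun x _ => (contDiff_term k).differentiable (by simp) x)
    (fun x _ => hφ.differentiable (by simp) x)
  · rw [h]
    simp only [fderiv_term]
  · simp only [fderiv_term]
    exact ((continuous_termGrad_apply k i).mul hφ.continuous).integrable_of_hasCompactSupport
      hφc.mul_left
  · exact (hc.mul hφ').integrable_of_hasCompactSupport (hasCompactSupport_term k).mul_right
  · exact (hc.mul hφ.continuous).integrable_of_hasCompactSupport hφc.mul_left

/-- Every point lies in at most one shell. -/
lemma exists_forall_ne_notMem (x : R3) : ∃ k, ∀ j, j ≠ k → x ∉ s.shell j := by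
  by_cases h : ∃ k, x ∈ s.shell k
  · obtain ⟨k, hk⟩ := h
    exact ⟨k, fun j hj hx => disjoint_left.1 (s.disjoint j k hj) hx hk⟩
  · push Not at h
    exact ⟨0, fun j _ => h j⟩

lemma hasSum_sum (x : R3) : HasSum (fun k => s.term k x) (s.sum x) := by
  obtain ⟨k, hk⟩ := s.exists_forall_ne_notMem x
  exact (hasSum_single k fun j hj => term_eq_zero (hk j hj)).summable.hasSum

lemma hasSum_sumGrad (x : R3) : HasSum (fun k => s.termGrad k x) (s.sumGrad x) := by
  obtain ⟨k, hk⟩ := s.exists_forall_ne_notMem x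
  exact (hasSum_single k fun j hj => termGrad_eq_zero (hk j hj)).summable.hasSum

/-- At each point at most one term is nonzero, so any function vanishing at `0` passes through the
sum. -/
lemma comp_sum {F : ℝ → ℝ≥0∞} (hF : F 0 = 0) (x : R3) : F (s.sum x) = ∑' k, F (s.term k x) := by
  obtain ⟨k, hk⟩ := s.exists_forall_ne_notMem x
  rw [sum, tsum_eq_single k fun j hj => term_eq_zero (hk j hj),
    tsum_eq_single k fun j hj => by rw [term_eq_zero (hk j hj), hF]]

lemma comp_sumGrad {F : R3 → ℝ≥0∞} (hF : F 0 = 0) (x : R3) :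
    F (s.sumGrad x) = ∑' k, F (s.termGrad k x) := by
  obtain ⟨k, hk⟩ := s.exists_forall_ne_notMem x
  rw [sumGrad, tsum_eq_single k fun j hj => termGrad_eq_zero (hk j hj),
    tsum_eq_single k fun j hj => by rw [termGrad_eq_zero (hk j hj), hF]]

lemma measurable_sum : Measurable s.sum := by
  refine measurable_of_tendsto_metrizable (f := fun n x => ∑ k ∈ Finset.range n, s.term k x)
    (fun n => Finset.measurable_sum _ fun k _ => (contDiff_term k).continuous.measurable) ?_
  exact tendsto_pi_nhds.2 fun x => (hasSum_sum x).tendsto_sum_nat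

lemma measurable_sumGrad : Measurable s.sumGrad := by
  refine measurable_of_tendsto_metrizable (f := fun n x => ∑ k ∈ Finset.range n, s.termGrad k x)
    (fun n => Finset.measurable_sum _ fun k _ => measurable_termGrad k) ?_
  exact tendsto_pi_nhds.2 fun x => (hasSum_sumGrad x).tendsto_sum_nat

lemma isRadial_sum : IsRadial s.sum :=
  ⟨fun r => ∑' k, s.h k * bump ((r - s.R k) / s.l k), Eventually.of_forall fun _ => rfl⟩

/-! ### Integrability, weak gradient and Coulomb energy of a sum of bumps. -/

lemma memLp_six_sum (h6 : Summable fun k => s.h k ^ 6 * (s.R k ^ 2 * s.l k)) :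
    MemLp s.sum 6 volume := by
  refine ⟨measurable_sum.aestronglyMeasurable, ?_⟩
  have hκ := sphereArea_pos
  rw [eLpNorm_lt_top_iff_lintegral_rpow_enorm_lt_top (by simp) (by simp)]
  simp only [ENNReal.toReal_ofNat]
  calc ∫⁻ x, ‖s.sum x‖ₑ ^ (6 : ℝ) = ∫⁻ x, ∑' k, ‖s.term k x‖ₑ ^ (6 : ℝ) :=
        lintegral_congr fun x => comp_sum (F := fun t => ‖t‖ₑ ^ (6 : ℝ)) (by simp) x
    _ = ∑' k, ∫⁻ x, ‖s.term k x‖ₑ ^ (6 : ℝ) :=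
        lintegral_tsum fun k =>
          ((contDiff_term k).continuous.measurable.enorm.pow_const _).aemeasurable
    _ ≤ ∑' k, ENNReal.ofReal (3 * sphereArea * (s.h k ^ 6 * (s.R k ^ 2 * s.l k))) := by
        refine ENNReal.tsum_le_tsum fun k => ?_
        have hh := s.h_pos k
        calc ∫⁻ x, ‖s.term k x‖ₑ ^ (6 : ℝ)
            ≤ ∫⁻ x, (s.shell k).indicator (fun _ => ENNReal.ofReal (s.h k ^ 6)) x := by
              refine lintegral_mono fun x => ?_
              by_cases hx : x ∈ s.shell k
              · rw [indicator_of_mem hx, ENNReal.ofReal_pow hh.le,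
                  show (6 : ℝ) = ((6 : ℕ) : ℝ) by norm_num, ENNReal.rpow_natCast]
                gcongr
                rw [Real.enorm_of_nonneg (term_nonneg k x)]
                exact ENNReal.ofReal_le_ofReal (term_le k x)
              · rw [term_eq_zero hx]
                simp
          _ = ENNReal.ofReal (s.h k ^ 6) * volume (s.shell k) :=
              lintegral_indicator_const (s.measurableSet_shell k) _
          _ ≤ _ := by
              refine (mul_le_mul_right (s.volume_shell_le k) _).trans (le_of_eq ?_)
              rw [← ENNReal.ofReal_mul (by positivity)]
              ring_nf
    _ < ⊤ := (h6.mul_left _).tsum_ofReal_lt_top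

lemma memLp_two_sumGrad (h2 : Summable fun k => s.h k ^ 2 * s.R k ^ 2 / s.l k) :
    MemLp s.sumGrad 2 volume := by
  refine ⟨measurable_sumGrad.aestronglyMeasurable, ?_⟩
  have hκ := sphereArea_pos
  obtain ⟨L, hL0, hL⟩ := exists_abs_deriv_bump_le
  rw [eLpNorm_lt_top_iff_lintegral_rpow_enorm_lt_top (by simp) (by simp)]
  simp only [ENNReal.toReal_ofNat, ENNReal.rpow_two]
  calc ∫⁻ x, ‖s.sumGrad x‖ₑ ^ 2 = ∫⁻ x, ∑' k, ‖s.termGrad k x‖ₑ ^ 2 :=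
        lintegral_congr fun x => comp_sumGrad (F := fun t => ‖t‖ₑ ^ 2) (by simp) x
    _ = ∑' k, ∫⁻ x, ‖s.termGrad k x‖ₑ ^ 2 :=
        lintegral_tsum fun k => ((measurable_termGrad k).enorm.pow_const _).aemeasurable
    _ ≤ ∑' k, ENNReal.ofReal (3 * sphereArea * L ^ 2 * (s.h k ^ 2 * s.R k ^ 2 / s.l k)) := by
        refine ENNReal.tsum_le_tsum fun k => ?_
        have hh := s.h_pos k
        have hl := s.l_pos k
        calc ∫⁻ x, ‖s.termGrad k x‖ₑ ^ 2
            ≤ ∫⁻ x, (s.shell k).indicator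
                (fun _ => ENNReal.ofReal ((s.h k / s.l k * L) ^ 2)) x := by
              refine lintegral_mono fun x => ?_
              by_cases hx : x ∈ s.shell k
              · rw [indicator_of_mem hx, ENNReal.ofReal_pow (by positivity)]
                gcongr
                rw [← ofReal_norm]
                exact ENNReal.ofReal_le_ofReal (norm_termGrad_le hL k x)
              · rw [termGrad_eq_zero hx]
                simp
          _ = ENNReal.ofReal ((s.h k / s.l k * L) ^ 2) * volume (s.shell k) :=
              lintegral_indicator_const (s.measurableSet_shell k) _
          _ ≤ _ := by
              refine (mul_le_mul_right (s.volume_shell_le k) _).trans (le_of_eq ?_)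
              rw [← ENNReal.ofReal_mul (by positivity)]
              congr 1
              field_simp
    _ < ⊤ := (h2.mul_left _).tsum_ofReal_lt_top

/-- Shells may accumulate at the origin, so the sum need not be locally finite. Integration by parts
is done termwise; disjointness turns the sum of absolute integrals into the absolute integral of the
sum, finite by local integrability, which justifies the exchange. -/
lemma isWeakGradient_sum (hu : MemLp s.sum 6 volume) (hg : MemLp s.sumGrad 2 volume) :
    IsWeakGradient s.sum s.sumGrad := by
  have hul := hu.locallyIntegrable (by norm_num)
  have hgl := hg.locallyIntegrable (by norm_num)
  refine ⟨hul, hgl, fun φ hφ hφc i => ?_⟩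
  have hφ' : Continuous fun x => fderiv ℝ φ x (EuclideanSpace.single i 1) :=
    (hφ.continuous_fderiv (by simp)).clm_apply continuous_const
  have hφc' : HasCompactSupport fun x => fderiv ℝ φ x (EuclideanSpace.single i 1) :=
    hφc.fderiv_apply ℝ _
  have hfin1 : ∑' k, ∫⁻ x, ‖s.term k x * fderiv ℝ φ x (EuclideanSpace.single i 1)‖ₑ ≠ ⊤ := by
    rw [← lintegral_tsum fun k => by
      exact (((contDiff_term k).continuous.mul hφ').measurable.enorm).aemeasurable]
    have h1 : ∀ x, ∑' k, ‖s.term k x * fderiv ℝ φ x (EuclideanSpace.single i 1)‖ₑ =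
        ‖s.sum x * fderiv ℝ φ x (EuclideanSpace.single i 1)‖ₑ := fun x =>
      (comp_sum (F := fun t => ‖t * fderiv ℝ φ x (EuclideanSpace.single i 1)‖ₑ) (by simp) x).symm
    simp only [h1]
    have h2 := hul.integrable_smul_left_of_hasCompactSupport hφ' hφc'
    simp only [smul_eq_mul, mul_comm (fderiv ℝ φ _ _)] at h2
    exact h2.2.ne
  have hfin2 : ∑' k, ∫⁻ x, ‖s.termGrad k x i * φ x‖ₑ ≠ ⊤ := by
    rw [← lintegral_tsum fun k => by
      exact (((continuous_termGrad_apply k i).mul hφ.continuous).measurable.enorm).aemeasurable]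
    have h1 : ∀ x, ∑' k, ‖s.termGrad k x i * φ x‖ₑ = ‖s.sumGrad x i * φ x‖ₑ := fun x =>
      (comp_sumGrad (F := fun t => ‖t i * φ x‖ₑ) (by simp) x).symm
    simp only [h1]
    have h2 := (hgl.apply_coord i).integrable_smul_left_of_hasCompactSupport hφ.continuous hφc
    simp only [smul_eq_mul, mul_comm (φ _)] at h2
    exact h2.2.ne
  calc ∫ x, s.sum x * fderiv ℝ φ x (EuclideanSpace.single i 1)
      = ∫ x, ∑' k, s.term k x * fderiv ℝ φ x (EuclideanSpace.single i 1) :=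
        integral_congr_ae (Eventually.of_forall fun x => ((hasSum_sum x).mul_right _).tsum_eq.symm)
    _ = ∑' k, ∫ x, s.term k x * fderiv ℝ φ x (EuclideanSpace.single i 1) :=
        integral_tsum (fun k => ((contDiff_term k).continuous.mul hφ').aestronglyMeasurable) hfin1
    _ = ∑' k, - ∫ x, s.termGrad k x i * φ x :=
        tsum_congr fun k => isWeakGradient_term_integral k hφ hφc i
    _ = - ∫ x, ∑' k, s.termGrad k x i * φ x := by
        have hm : ∀ k, AEStronglyMeasurable (fun x => s.termGrad k x i * φ x) volume := fun k =>
          ((continuous_termGrad_apply k i).mul hφ.continuous).aestronglyMeasurable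
        rw [tsum_neg, integral_tsum hm hfin2]
    _ = - ∫ x, s.sumGrad x i * φ x := by
        congr 1
        refine integral_congr_ae (Eventually.of_forall fun x => ?_)
        have h1 := (hasSum_sumGrad (s := s) x).mapL (EuclideanSpace.proj i : R3 →L[ℝ] ℝ)
        exact (h1.mul_right (φ x)).tsum_eq

/-- The mutualEnergy Coulomb energy of two shells. -/
noncomputable def mutualEnergy (s : Shells) (j k : ℕ) : ℝ≥0∞ :=
  ∫⁻ x in s.shell j, ∫⁻ y in s.shell k, ENNReal.ofReal (1 / ‖x - y‖)

lemma mutualEnergy_comm (j k : ℕ) : s.mutualEnergy j k = s.mutualEnergy k j := by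
  unfold mutualEnergy
  rw [lintegral_lintegral_swap (Measurable.aemeasurable (by fun_prop))]
  simp_rw [norm_sub_rev]

lemma mutualEnergy_le (j k : ℕ) : s.mutualEnergy j k ≤
    ENNReal.ofReal (3456 * sphereArea * (s.R j ^ 2 * s.l j) * (s.R k * s.l k)) := by
  have hκ := sphereArea_pos
  have hj := s.R_pos j
  have hlj := s.l_pos j
  calc s.mutualEnergy j k ≤ ∫⁻ _ in s.shell j, ENNReal.ofReal (1152 * (s.l k * s.R k)) :=
        lintegral_mono fun x => lintegral_shell_le (s.l_pos k) (s.l_le k) x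
    _ = ENNReal.ofReal (1152 * (s.l k * s.R k)) * volume (s.shell j) := setLIntegral_const _ _
    _ ≤ _ := by
        refine (mul_le_mul_right (s.volume_shell_le j) _).trans (le_of_eq ?_)
        rw [mul_comm, ← ENNReal.ofReal_mul (by positivity)]
        ring_nf

/-- Apply the potential bound to the shell of larger radius and use `√(R j) * √(R k) ≤ R k`. The
product form is what makes the double sum over shells factor. -/
lemma mutualEnergy_le_symm (j k : ℕ) : s.mutualEnergy j k ≤ ENNReal.ofReal (3456 * sphereArea *
    ((s.R j ^ 2 * s.l j / √(s.R j)) * (s.R k ^ 2 * s.l k / √(s.R k)))) := by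
  have hκ := sphereArea_pos
  have key : ∀ j k, s.R j ≤ s.R k → s.mutualEnergy j k ≤ ENNReal.ofReal (3456 * sphereArea *
      ((s.R j ^ 2 * s.l j / √(s.R j)) * (s.R k ^ 2 * s.l k / √(s.R k)))) := by
    intro j k hjk
    have hj := s.R_pos j
    have hk := s.R_pos k
    have hlj := s.l_pos j
    have hlk := s.l_pos k
    refine (mutualEnergy_le j k).trans (ENNReal.ofReal_le_ofReal ?_)
    have h1 : √(s.R j) * √(s.R k) ≤ s.R k := by
      calc _ ≤ √(s.R k) * √(s.R k) := by gcongr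
        _ = _ := Real.mul_self_sqrt hk.le
    have h2 : 0 < √(s.R j) * √(s.R k) := by positivity
    have h3 : s.R k * s.l k ≤ s.R k ^ 2 * s.l k / (√(s.R j) * √(s.R k)) := by
      rw [le_div_iff₀ h2]
      nlinarith [mul_pos hk hlk]
    calc _ ≤ 3456 * sphereArea * (s.R j ^ 2 * s.l j) *
          (s.R k ^ 2 * s.l k / (√(s.R j) * √(s.R k))) := by gcongr
      _ = _ := by
        field_simp
  rcases le_total (s.R j) (s.R k) with h | h
  · exact key j k h
  · rw [mutualEnergy_comm]
    refine (key k j h).trans (le_of_eq ?_)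
    ring_nf

/-- Dominate the squared function by step functions on the shells and expand; the product bound on
mutual energies yields a multiple of the square of the assumed sum. -/
lemma energy_sum_lt_top
    (he : Summable fun k => s.h k ^ 2 * (s.R k ^ 2 * s.l k / √(s.R k))) :
    energy s.sum < ⊤ := by
  have hκ := sphereArea_pos
  set ρ : ℕ → R3 → ℝ≥0∞ := fun k => (s.shell k).indicator fun _ => ENNReal.ofReal (s.h k ^ 2)
    with hρ
  have hρm : ∀ k, Measurable (ρ k) := fun k => measurable_const.indicator (s.measurableSet_shell k)
  have hle : ∀ x, ENNReal.ofReal (s.sum x ^ 2) ≤ ∑' k, ρ k x := by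
    intro x
    rw [comp_sum (F := fun t => ENNReal.ofReal (t ^ 2)) (by simp) x]
    refine ENNReal.tsum_le_tsum fun k => ?_
    by_cases hx : x ∈ s.shell k
    · simp only [hρ]
      rw [indicator_of_mem hx]
      refine ENNReal.ofReal_le_ofReal ?_
      exact pow_le_pow_left₀ (term_nonneg k x) (term_le k x) 2
    · rw [term_eq_zero hx]
      simp
  have hinner : ∀ x, ∫⁻ y, (∑' k, ρ k y) * ENNReal.ofReal (1 / ‖x - y‖) =
      ∑' k, ENNReal.ofReal (s.h k ^ 2) *
        ∫⁻ y in s.shell k, ENNReal.ofReal (1 / ‖x - y‖) := by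
    intro x
    simp_rw [← ENNReal.tsum_mul_right]
    have hm : ∀ k, Measurable fun y => ρ k y * ENNReal.ofReal (1 / ‖x - y‖) := fun k =>
      (hρm k).mul (by fun_prop)
    rw [lintegral_tsum fun k => (hm k).aemeasurable]
    refine tsum_congr fun k => ?_
    rw [← lintegral_const_mul' _ _ ENNReal.ofReal_ne_top,
      ← lintegral_indicator (s.measurableSet_shell k)]
    refine lintegral_congr fun y => ?_
    by_cases hy : y ∈ s.shell k <;> simp [hρ, hy]
  have hVm : ∀ k, Measurable fun x : R3 =>
      ∫⁻ y in s.shell k, ENNReal.ofReal (1 / ‖x - y‖) := fun k =>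
    Measurable.lintegral_prod_right' (f := fun q : R3 × R3 => ENNReal.ofReal (1 / ‖q.1 - q.2‖))
      (by fun_prop)
  calc energy s.sum ≤ ∫⁻ x, (∑' j, ρ j x) *
        ∑' k, ENNReal.ofReal (s.h k ^ 2) *
          ∫⁻ y in s.shell k, ENNReal.ofReal (1 / ‖x - y‖) := by
        refine lintegral_mono fun x => ?_
        rw [← hinner x]
        calc _ = ∫⁻ y, ENNReal.ofReal (s.sum x ^ 2) *
              (ENNReal.ofReal (s.sum y ^ 2) * ENNReal.ofReal (1 / ‖x - y‖)) := by
              refine lintegral_congr fun y => ?_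
              rw [← ENNReal.ofReal_mul (by positivity), ← ENNReal.ofReal_mul (by positivity)]
              ring_nf
          _ = ENNReal.ofReal (s.sum x ^ 2) * ∫⁻ y,
              ENNReal.ofReal (s.sum y ^ 2) * ENNReal.ofReal (1 / ‖x - y‖) :=
              lintegral_const_mul' _ _ ENNReal.ofReal_ne_top
          _ ≤ _ := by
              refine mul_le_mul' (hle x) (lintegral_mono fun y => ?_)
              exact mul_le_mul_left (hle y) _
    _ = ∑' j, ∑' k,
        ENNReal.ofReal (s.h j ^ 2) * ENNReal.ofReal (s.h k ^ 2) * s.mutualEnergy j k := by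
        simp_rw [← ENNReal.tsum_mul_right, ← ENNReal.tsum_mul_left]
        have hm : ∀ j k, Measurable fun x => ρ j x * (ENNReal.ofReal (s.h k ^ 2) *
            ∫⁻ y in s.shell k, ENNReal.ofReal (1 / ‖x - y‖)) := fun j k =>
          (hρm j).mul ((hVm k).const_mul _)
        rw [lintegral_tsum fun j => (Measurable.tsum fun k => hm j k).aemeasurable]
        refine tsum_congr fun j => ?_
        rw [lintegral_tsum fun k => (hm j k).aemeasurable]
        refine tsum_congr fun k => ?_
        rw [mutualEnergy, ← lintegral_const_mul' _ _
          (ENNReal.mul_ne_top ENNReal.ofReal_ne_top ENNReal.ofReal_ne_top),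
          ← lintegral_indicator (s.measurableSet_shell j)]
        refine lintegral_congr fun x => ?_
        by_cases hx : x ∈ s.shell j <;> simp [hρ, hx, mul_assoc]
    _ ≤ ∑' j, ∑' k, ENNReal.ofReal (3456 * sphereArea) *
        (ENNReal.ofReal (s.h j ^ 2 * (s.R j ^ 2 * s.l j / √(s.R j))) *
          ENNReal.ofReal (s.h k ^ 2 * (s.R k ^ 2 * s.l k / √(s.R k)))) := by
        refine ENNReal.tsum_le_tsum fun j => ENNReal.tsum_le_tsum fun k => ?_
        have hlj := s.l_pos j
        have hlk := s.l_pos k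
        refine (mul_le_mul_right (mutualEnergy_le_symm j k) _).trans (le_of_eq ?_)
        rw [← ENNReal.ofReal_mul (by positivity), ← ENNReal.ofReal_mul (by positivity),
          ← ENNReal.ofReal_mul (by positivity), ← ENNReal.ofReal_mul (by positivity)]
        ring_nf
    _ < ⊤ := by
        simp_rw [ENNReal.tsum_mul_left, ENNReal.tsum_mul_right]
        exact ENNReal.mul_lt_top ENNReal.ofReal_lt_top
          (ENNReal.mul_lt_top he.tsum_ofReal_lt_top he.tsum_ofReal_lt_top)

theorem memEr_sum (h6 : Summable fun k => s.h k ^ 6 * (s.R k ^ 2 * s.l k))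
    (h2 : Summable fun k => s.h k ^ 2 * s.R k ^ 2 / s.l k)
    (he : Summable fun k => s.h k ^ 2 * (s.R k ^ 2 * s.l k / √(s.R k))) : MemEr s.sum :=
  have hu := memLp_six_sum h6
  have hg := memLp_two_sumGrad h2
  ⟨⟨hu, s.sumGrad, isWeakGradient_sum hu hg, hg⟩, energy_sum_lt_top he, isRadial_sum⟩

/-- The bump equals `1` on the middle half of its shell, so each shell contributes at least
`sphereArea / 2`. -/
theorem not_memLp_sum {p : ℝ≥0∞} (hp0 : p ≠ 0) (hpt : p ≠ ⊤)
    (hp : ∀ k, 1 ≤ s.h k ^ p.toReal * (s.R k ^ 2 * s.l k)) : ¬ MemLp s.sum p volume := by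
  intro hmem
  have hκ := sphereArea_pos
  have hfin := lintegral_rpow_enorm_lt_top_of_eLpNorm_lt_top hp0 hpt hmem.2
  have hpr : 0 < p.toReal := ENNReal.toReal_pos hp0 hpt
  refine hfin.ne (top_le_iff.1 ?_)
  have hc : ENNReal.ofReal (sphereArea / 2) ≠ 0 := by
    rw [Ne, ENNReal.ofReal_eq_zero, not_le]; positivity
  calc (⊤ : ℝ≥0∞) = ∑' _ : ℕ, ENNReal.ofReal (sphereArea / 2) :=
        (ENNReal.tsum_const_eq_top_of_ne_zero hc).symm
    _ ≤ ∑' k, ∫⁻ x, ‖s.term k x‖ₑ ^ p.toReal := by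
        refine ENNReal.tsum_le_tsum fun k => ?_
        have hR := s.R_pos k
        have hl := s.l_pos k
        have hh := s.h_pos k
        set A : Set R3 := {x : R3 | ‖x‖ ∈ Ioc (s.R k + s.l k / 4) (s.R k + 3 * s.l k / 4)} with hA
        have hAm : MeasurableSet A := measurableSet_norm_mem measurableSet_Ioc
        have hvol : ENNReal.ofReal (sphereArea / 2 * (s.R k ^ 2 * s.l k)) ≤ volume A := by
          rw [hA, volume_norm_mem_Ioc (by positivity) (by linarith)]
          refine ENNReal.ofReal_le_ofReal ?_
          have h1 : s.R k ^ 2 * s.l k / 2 ≤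
              ((s.R k + 3 * s.l k / 4) ^ 3 - (s.R k + s.l k / 4) ^ 3) / 3 := by
            nlinarith [mul_pos hR hl, mul_pos hR (pow_pos hl 2), pow_pos hl 3]
          nlinarith
        calc ENNReal.ofReal (sphereArea / 2)
            ≤ ENNReal.ofReal (s.h k ^ p.toReal) *
                ENNReal.ofReal (sphereArea / 2 * (s.R k ^ 2 * s.l k)) := by
              rw [← ENNReal.ofReal_mul (by positivity)]
              refine ENNReal.ofReal_le_ofReal ?_
              nlinarith [hp k]
          _ ≤ ENNReal.ofReal (s.h k ^ p.toReal) * volume A := by gcongr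
          _ = ∫⁻ _ in A, ENNReal.ofReal (s.h k ^ p.toReal) := (setLIntegral_const _ _).symm
          _ ≤ ∫⁻ x in A, ‖s.term k x‖ₑ ^ p.toReal := by
              refine setLIntegral_mono' hAm fun x hx => le_of_eq ?_
              have h1 : (‖x‖ - s.R k) / s.l k ∈ Icc (1 / 4 : ℝ) (3 / 4) := by
                have hx1 : s.R k + s.l k / 4 < ‖x‖ := hx.1
                have hx2 : ‖x‖ ≤ s.R k + 3 * s.l k / 4 := hx.2
                constructor
                · rw [le_div_iff₀ hl]; linarith
                · rw [div_le_iff₀ hl]; linarith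
              rw [term, bump_eq_one h1, mul_one, Real.enorm_of_nonneg hh.le,
                ENNReal.ofReal_rpow_of_nonneg hh.le hpr.le]
          _ ≤ _ := setLIntegral_le_lintegral _ _
    _ = ∫⁻ x, ∑' k, ‖s.term k x‖ₑ ^ p.toReal :=
        (lintegral_tsum fun k =>
          ((contDiff_term k).continuous.measurable.enorm.pow_const _).aemeasurable).symm
    _ = ∫⁻ x, ‖s.sum x‖ₑ ^ p.toReal :=
        lintegral_congr fun x => (comp_sum (F := fun t => ‖t‖ₑ ^ p.toReal)
          (by simp [ENNReal.zero_rpow_of_pos hpr]) x).symm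

end Shells

/-! ### Failure of the inclusion -/

lemma summable_two_rpow_pow {a : ℝ} (ha : a < 0) : Summable fun k : ℕ => ((2 : ℝ) ^ a) ^ k :=
  summable_geometric_of_lt_one (by positivity)
    (Real.rpow_lt_one_of_one_lt_of_neg (by norm_num) ha)

/-- Shells with radii, thicknesses and heights in geometric progression. -/
noncomputable def geometricShells (α β γ : ℝ)
    (hle : ∀ k : ℕ, ((2 : ℝ) ^ β) ^ k ≤ ((2 : ℝ) ^ α) ^ k)
    (hd : ∀ j k : ℕ, j ≠ k →
      Disjoint (Ioc (((2 : ℝ) ^ α) ^ j) (((2 : ℝ) ^ α) ^ j + ((2 : ℝ) ^ β) ^ j))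
        (Ioc (((2 : ℝ) ^ α) ^ k) (((2 : ℝ) ^ α) ^ k + ((2 : ℝ) ^ β) ^ k))) : Shells where
  R k := ((2 : ℝ) ^ α) ^ k
  l k := ((2 : ℝ) ^ β) ^ k
  h k := ((2 : ℝ) ^ γ) ^ k
  l_pos k := by positivity
  l_le := hle
  h_pos k := by positivity
  disjoint := hd

lemma two_rpow_pow (a : ℝ) (k : ℕ) : ((2 : ℝ) ^ a) ^ k = (2 : ℝ) ^ (a * k) := by
  rw [← Real.rpow_natCast, ← Real.rpow_mul (by norm_num)]

/-- For geometric progressions the summability conditions become linear in the exponents: `h6`, `h2`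
and `he` encode `L⁶`, the gradient and the energy. -/
lemma exists_memEr_of_exponents {α β γ : ℝ}
    (hle : ∀ k : ℕ, ((2 : ℝ) ^ β) ^ k ≤ ((2 : ℝ) ^ α) ^ k)
    (hd : ∀ j k : ℕ, j ≠ k →
      Disjoint (Ioc (((2 : ℝ) ^ α) ^ j) (((2 : ℝ) ^ α) ^ j + ((2 : ℝ) ^ β) ^ j))
        (Ioc (((2 : ℝ) ^ α) ^ k) (((2 : ℝ) ^ α) ^ k + ((2 : ℝ) ^ β) ^ k)))
    (h6 : 6 * γ + 2 * α + β < 0) (h2 : 2 * γ + 2 * α - β < 0)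
    (he : 2 * γ + 3 / 2 * α + β < 0) {p : ℝ≥0∞} (hp0 : p ≠ 0) (hpt : p ≠ ⊤)
    (hp : 0 ≤ p.toReal * γ + 2 * α + β) :
    ∃ u : R3 → ℝ, MemEr u ∧ ¬ MemLp u p volume := by
  have two_pos : (0 : ℝ) < 2 := by norm_num
  refine ⟨(geometricShells α β γ hle hd).sum, Shells.memEr_sum ?_ ?_ ?_,
    Shells.not_memLp_sum hp0 hpt ?_⟩
  · refine (summable_two_rpow_pow h6).congr fun k => ?_
    simp only [geometricShells, two_rpow_pow]
    rw [← Real.rpow_add two_pos, ← Real.rpow_add two_pos]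
    congr 1
    push_cast
    ring
  · refine (summable_two_rpow_pow h2).congr fun k => ?_
    simp only [geometricShells, two_rpow_pow]
    rw [← Real.rpow_add two_pos, ← Real.rpow_sub two_pos]
    congr 1
    push_cast
    ring
  · refine (summable_two_rpow_pow he).congr fun k => ?_
    simp only [geometricShells, two_rpow_pow]
    rw [Real.sqrt_eq_rpow, ← Real.rpow_mul two_pos.le, ← Real.rpow_add two_pos,
      ← Real.rpow_sub two_pos, ← Real.rpow_add two_pos]
    congr 1
    push_cast
    ring
  · intro k
    simp only [geometricShells, two_rpow_pow]
    rw [← Real.rpow_mul two_pos.le, ← Real.rpow_add two_pos, ← Real.rpow_add two_pos]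
    refine Real.one_le_rpow (by norm_num) ?_
    push_cast
    have : (0 : ℝ) ≤ k := Nat.cast_nonneg k
    nlinarith

/-- Small exponents: thin shells escaping to infinity. -/
lemma exists_memEr_not_memLp_of_lt {p : ℝ≥0∞} (hp0 : 0 < p) (hp : p < 18 / 7) :
    ∃ u : R3 → ℝ, MemEr u ∧ ¬ MemLp u p volume := by
  have hpt : p ≠ ⊤ := (hp.trans_le le_top).ne
  have hpr : 0 < p.toReal := ENNReal.toReal_pos hp0.ne' hpt
  have hpr7 : p.toReal < 18 / 7 := by
    have := (ENNReal.toReal_lt_toReal hpt (ENNReal.div_ne_top (by simp) (by simp))).2 hp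
    simpa using this
  have e1 : (2 : ℝ) ^ (1 : ℝ) = 2 := Real.rpow_one 2
  have e4 : (2 : ℝ) ^ (4 : ℝ) = 16 := by norm_cast
  -- With radius `16 ^ k` and thickness `2 ^ k`, gradient and energy both require `γ < -7/2`, that
  -- is, height below `R ^ (-7/8)`. The choice `-9 / p` makes the `L^p` exponent zero and meets this
  -- exactly when `p < 18/7`.
  have hγ : -9 / p.toReal < -7 / 2 := by
    rw [div_lt_iff₀ hpr]; linarith
  refine exists_memEr_of_exponents (α := 4) (β := 1) (γ := -9 / p.toReal) ?_ ?_ (by linarith)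
    (by linarith) (by linarith) hp0.ne' hpt ?_
  · intro k
    rw [e1, e4]
    gcongr
    norm_num
  · rw [e1, e4]
    have key : ∀ j k : ℕ, j < k →
        Disjoint (Ioc ((16 : ℝ) ^ j) (16 ^ j + 2 ^ j)) (Ioc ((16 : ℝ) ^ k) (16 ^ k + 2 ^ k)) := by
      intro j k hjk
      rw [disjoint_left]
      intro t ht1 ht2
      have h1 : (16 : ℝ) ^ (j + 1) ≤ 16 ^ k := pow_le_pow_right₀ (by norm_num) hjk
      have h2 : (2 : ℝ) ^ j ≤ 16 ^ j := pow_le_pow_left₀ (by norm_num) (by norm_num) j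
      have h3 : (0 : ℝ) < 16 ^ j := by positivity
      rw [pow_succ] at h1
      linarith [ht1.2, ht2.1]
    intro j k hjk
    rcases lt_or_gt_of_ne hjk with h | h
    · exact key j k h
    · exact (key k j h).symm
  · rw [mul_div_cancel₀ _ hpr.ne']
    norm_num

/-- Large finite exponents: shells concentrating at the origin. -/
lemma exists_memEr_not_memLp_of_gt {p : ℝ≥0∞} (hpt : p ≠ ⊤) (hp : 6 < p) :
    ∃ u : R3 → ℝ, MemEr u ∧ ¬ MemLp u p volume := by
  have hp0 : p ≠ 0 := (zero_le.trans_lt hp).ne'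
  have hpr6 : 6 < p.toReal := by
    have := (ENNReal.toReal_lt_toReal (by simp) hpt).2 hp
    simpa using this
  have hpr : 0 < p.toReal := by linarith
  have e1 : (2 : ℝ) ^ (-1 : ℝ) = 1 / 2 := by rw [Real.rpow_neg_one]; norm_num
  -- For radius and thickness `2 ^ (-k)`, the `L⁶` and gradient conditions both read `γ < 1/2`,
  -- while `3 / p` makes the `L^p` exponent zero.
  have hγ : 3 / p.toReal < 1 / 2 := by
    rw [div_lt_iff₀ hpr]; linarith
  refine exists_memEr_of_exponents (α := -1) (β := -1) (γ := 3 / p.toReal) (fun _ => le_rfl) ?_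
    (by linarith) (by linarith) (by linarith) hp0 hpt ?_
  · rw [e1]
    have key : ∀ j k : ℕ, j < k → Disjoint (Ioc ((1 / 2 : ℝ) ^ j) ((1 / 2) ^ j + (1 / 2) ^ j))
        (Ioc ((1 / 2 : ℝ) ^ k) ((1 / 2) ^ k + (1 / 2) ^ k)) := by
      intro j k hjk
      rw [disjoint_left]
      intro t ht1 ht2
      have h1 : (1 / 2 : ℝ) ^ k ≤ (1 / 2) ^ (j + 1) :=
        pow_le_pow_of_le_one (by norm_num) (by norm_num) hjk
      rw [pow_succ] at h1
      linarith [ht1.1, ht2.2]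
    intro j k hjk
    rcases lt_or_gt_of_ne hjk with h | h
    · exact key j k h
    · exact (key k j h).symm
  · rw [mul_div_cancel₀ _ hpr.ne']
    norm_num

/-- Reduces `p = ∞` to a finite exponent above `6`: the example outside `L⁷` cannot be bounded,
since it lies in `L⁶`. -/
lemma memLp_seven_of_memLp_top {u : R3 → ℝ} (h6 : MemLp u 6 volume) (ht : MemLp u ⊤ volume) :
    MemLp u 7 volume := by
  refine ⟨h6.1, ?_⟩
  have h1 := lintegral_rpow_enorm_lt_top_of_eLpNorm_lt_top (by simp) (by simp) h6.2
  rw [eLpNorm_lt_top_iff_lintegral_rpow_enorm_lt_top (by simp) (by simp)]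
  simp only [ENNReal.toReal_ofNat] at h1 ⊢
  have htop : eLpNormEssSup u volume < ⊤ := by simpa using ht.2
  calc ∫⁻ x, ‖u x‖ₑ ^ (7 : ℝ) ≤ ∫⁻ x, eLpNormEssSup u volume * ‖u x‖ₑ ^ (6 : ℝ) := by
        refine lintegral_mono_ae ?_
        filter_upwards [enorm_ae_le_eLpNormEssSup u volume] with x hx
        calc ‖u x‖ₑ ^ (7 : ℝ) = ‖u x‖ₑ * ‖u x‖ₑ ^ (6 : ℝ) := by
              norm_cast
              rw [← pow_succ']
          _ ≤ _ := by gcongr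
    _ < ⊤ := by
        rw [lintegral_const_mul' _ _ htop.ne]
        exact ENNReal.mul_lt_top htop h1

theorem not_included (p : ℝ≥0∞) (hp0 : 0 < p) (hp : p < 18 / 7 ∨ 6 < p) :
    ∃ u : R3 → ℝ, MemEr u ∧ ¬ MemLp u p volume := by
  rcases hp with hp | hp
  · exact exists_memEr_not_memLp_of_lt hp0 hp
  · by_cases hpt : p = ⊤
    · obtain ⟨u, hu, h7⟩ := exists_memEr_not_memLp_of_gt (p := 7) (by simp) (by norm_num)
      exact ⟨u, hu, fun h => h7 (memLp_seven_of_memLp_top hu.memD12.memLp_six (hpt ▸ h))⟩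
    · exact exists_memEr_not_memLp_of_gt hpt hp

end Coulomb

theorem theorem1p2 :
    -- continuous inclusion for `p ∈ (18/7, 6]`
    (∀ p : ℝ≥0∞, 18 / 7 < p → p ≤ 6 →
      ∃ C : ℝ≥0, ∀ u : Coulomb.R3 → ℝ, Coulomb.MemEr u →
        MemLp u p volume ∧ eLpNorm u p volume ≤ C * Coulomb.normE u) ∧
    -- compact inclusion for `p ∈ (18/7, 6)`: bounded sequences of `E_r` have subsequences
    -- that converge in `L^p`
    (∀ p : ℝ≥0∞, 18 / 7 < p → p < 6 →
      ∀ u : ℕ → Coulomb.R3 → ℝ, (∀ n, Coulomb.MemEr (u n)) →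
        (∃ M : ℝ≥0, ∀ n, Coulomb.normE (u n) ≤ M) →
        ∃ k : ℕ → ℕ, StrictMono k ∧ ∃ v : Coulomb.R3 → ℝ, MemLp v p volume ∧
          Tendsto (fun n => eLpNorm (u (k n) - v) p volume) atTop (𝓝 0)) ∧
    -- no inclusion for `p < 18/7` or `p > 6`
    (∀ p : ℝ≥0∞, 0 < p → (p < 18 / 7 ∨ 6 < p) →
      ∃ u : Coulomb.R3 → ℝ, Coulomb.MemEr u ∧ ¬ MemLp u p volume) :=
  ⟨Coulomb.continuous_inclusion, Coulomb.compact_inclusion, Coulomb.not_included⟩
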